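/- Let $d\ge 1$, $a\in(0,1]$, $\sigma>0$, and let $\phi_a(z)=z$ for $z>0$ and $\phi_a(z)=az$ for $z\le 0$, applied componentwise to vectors. Consider the fully connected network $x^{(k+1)}=\phi_a(W^{(k+1)}x^{(k)}+b^{(k+1)})$, $k\ge 0$, with a deterministic input $x^{(0)}\in\mathbb R^d$, $x^{(0)}\ne 0$, under Gaussian initialization: all the entries of all the weight matrices $W^{(k)}\in\mathbb R^{d\times d}$, $k\geq 1$, are i.i.d. $\mathcal N(0,\sigma^2)$, and all biases $b^{(k)}$ are zero. Let $\psi_0=\Gamma'/\Gamma$ and $\psi_1=\psi_0'$ be the digamma and trigamma functions, $\mathrm B$ the Beta function, $\gamma$ the Euler–Mascheroni constant, $\binom{r}{k}=r(r-1)\cdots(r-k+1)/k!$ for $r\in\mathbb R$, and for $0\le n\le d$, $k\ge 0$ put $$p_d(n)=\binom dn 2^{-d},\qquad w_{k,n}=\tfrac12(1-a^2)^k\left[n\binom{\frac{d-n}2+k-1}{k}+a^2(d-n)\binom{\frac{d-n}2+k}{k}\right],$$ $$m_n=\sum_{k=0}^\infty w_{k,n}\bigl(\psi_0(\tfrac d2)-\psi_0(k+1)\bigr)\mathrm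 B(k+1,\tfrac d2)+\log 2-\gamma,$$ $$v_n=\psi_1(\tfrac d2)+\sum_{k=0}^\infty\bigl[\psi_1(k+1)-\psi_1(1)\bigr]w_{k,n}\mathrm B(k+1,\tfrac d2)+\sum_{k=0}^\infty\bigl[\psi_0(\tfrac d2)-\psi_0(k+1)\bigr]^2w_{k,n}\mathrm B(k+1,\tfrac d2)-\Bigl[\sum_{k=0}^\infty\bigl(\psi_0(\tfrac d2)-\psi_0(k+1)\bigr)w_{k,n}\mathrm B(k+1,\tfrac d2)\Bigr]^2,$$ $$\mu_a(\sigma)=\log\sigma+\frac12\sum_{n=0}^d p_d(n)m_n,\qquad s_a^2=\frac14\left[\sum_{n=0}^d p_d(n)v_n+\sum_{n=0}^d p_d(n)m_n^2-\Bigl(\sum_{n=0}^d p_d(n)m_n\Bigr)^2\right].$$ All these series converge (absolutely) and $s_a^2\ge 0$. Moreover $\mathbb P(x^{(k)}=0)=0$ for every $k\geq 0$, and for every $k\ge 1$ the conditional law of $\log\|x^{(k)}\|$ given $x^{(k)}\ne 0$ (with $\|\cdot\|$ the Euclidean norm) has a density $f_{k,a}$ with respect to Lebesgue measure, which is also the density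 of the unconditional law of $\log\|x^{(k)}\|$. Furthermore: 1. Almost surely, $\frac1k\log\|x^{(k)}\|\to\mu_a(\sigma)$ as $k\to\infty$; in particular the limit is deterministic and does not depend on $x^{(0)}$. 2. Let $(R_{k,a})_{k}$ be any sequence of random variables on a common probability space such that $R_{k,a}$ has density $f_{k,a}$ for every $k\ge1$ (for instance $R_{k,a}=\log\|x^{(k)}\|$). Then $\frac{R_{k,a}}{k}\to\mu_a(\sigma)$ in probability, and $$\frac{R_{k,a}-\mu_a(\sigma)k}{\sqrt k}\Rightarrow\mathcal N(0,s_a^2)\quad\text{in distribution as }k\to\infty.$$ -/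

import Mathlib

universe u v

/-- The parametric ReLU activation function: `z ↦ z` for `z > 0` and `z ↦ a z` for `z ≤ 0`. -/
noncomputable def prelu (a z : ℝ) : ℝ := if 0 < z then z else a * z

/-- One layer of the network, `x ↦ φ_a (W x + b)` with `φ_a` applied componentwise. -/
noncomputable def layerMap {d : ℕ} (a : ℝ) (W : Matrix (Fin d) (Fin d) ℝ)
    (b x : EuclideanSpace ℝ (Fin d)) : EuclideanSpace ℝ (Fin d) :=
  WithLp.toLp 2 fun i => prelu a (W.mulVec x.ofLp i + b i)

/-- The output `x^(k)` of the `k`-th layer of the network with input `x₀`.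
Here `W k` and `b k` are the weight matrix and the bias of layer `k + 1`. -/
noncomputable def netOutput {d : ℕ} (a : ℝ) (W : ℕ → Matrix (Fin d) (Fin d) ℝ)
    (b : ℕ → EuclideanSpace ℝ (Fin d)) (x₀ : EuclideanSpace ℝ (Fin d)) :
    ℕ → EuclideanSpace ℝ (Fin d)
  | 0 => x₀
  | k + 1 => layerMap a (W k) (b k) (netOutput a W b x₀ k)

/-- Gaussian initialization: all the entries of all the weight matrices are i.i.d. with law
`N(0, σ²)`, and all the biases are zero. -/
structure IsGaussianInit {Ω : Type*} [MeasurableSpace Ω] (P : MeasureTheory.Measure Ω) {d : ℕ}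
    (σ : ℝ) (W : ℕ → Ω → Matrix (Fin d) (Fin d) ℝ) (b : ℕ → EuclideanSpace ℝ (Fin d)) :
    Prop where
  measurable_weight : ∀ k i j, Measurable fun ω => W k ω i j
  weight_law : ∀ k i j,
    P.map (fun ω => W k ω i j) = ProbabilityTheory.gaussianReal 0 (σ ^ 2).toNNReal
  weight_indep :
    ProbabilityTheory.iIndepFun (fun (p : ℕ × Fin d × Fin d) ω => W p.1 ω p.2.1 p.2.2) P
  bias_zero : ∀ k, b k = 0

/-- The logarithm of the Euclidean norm of the output of the `k`-th layer, as a random variable. -/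
noncomputable def logNormOutput {Ω : Type*} {d : ℕ} (a : ℝ)
    (W : ℕ → Ω → Matrix (Fin d) (Fin d) ℝ) (b : ℕ → EuclideanSpace ℝ (Fin d))
    (x₀ : EuclideanSpace ℝ (Fin d)) (k : ℕ) (ω : Ω) : ℝ :=
  Real.log ‖netOutput a (fun j => W j ω) b x₀ k‖

/-- The event that the output of the `k`-th layer is not zero. -/
def outputNeZero {Ω : Type*} {d : ℕ} (a : ℝ)
    (W : ℕ → Ω → Matrix (Fin d) (Fin d) ℝ) (b : ℕ → EuclideanSpace ℝ (Fin d))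
    (x₀ : EuclideanSpace ℝ (Fin d)) (k : ℕ) : Set Ω :=
  {ω | netOutput a (fun j => W j ω) b x₀ k ≠ 0}

/-- The conditional probability density function `f_{k,a}` of `log ‖x^(k)‖` given
`x^(k) ≠ 0`, with respect to Lebesgue measure. -/
noncomputable def logNormDensity {Ω : Type*} [MeasurableSpace Ω]
    (P : MeasureTheory.Measure Ω) {d : ℕ} (a : ℝ)
    (W : ℕ → Ω → Matrix (Fin d) (Fin d) ℝ) (b : ℕ → EuclideanSpace ℝ (Fin d))
    (x₀ : EuclideanSpace ℝ (Fin d)) (k : ℕ) : ℝ → ENNReal :=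
  MeasureTheory.pdf (logNormOutput a W b x₀ k)
    (ProbabilityTheory.cond P (outputNeZero a W b x₀ k)) MeasureTheory.volume

/-- The digamma function `ψ₀ = Γ' / Γ` on the positive reals. -/
noncomputable def psiZero (x : ℝ) : ℝ := deriv Real.Gamma x / Real.Gamma x

/-- The trigamma function `ψ₁ = ψ₀'` on the positive reals. -/
noncomputable def psiOne (x : ℝ) : ℝ := deriv psiZero x

/-- The binomial weight `p_d(n) = C(d, n) / 2^d`. -/
noncomputable def binomWeight (d n : ℕ) : ℝ := (d.choose n : ℝ) / 2 ^ d

/-- The coefficient `w_{k,n}`; `Ring.choose r k` is the generalized binomial coefficient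
`r (r - 1) ⋯ (r - k + 1) / k!` of a real number `r`. -/
noncomputable def wCoeff (a : ℝ) (d n k : ℕ) : ℝ :=
  1 / 2 * (1 - a ^ 2) ^ k *
    (Ring.choose (((d : ℝ) - n) / 2 + k - 1) k * n
      + a ^ 2 * ((d : ℝ) - n) * Ring.choose (((d : ℝ) - n) / 2 + k) k)

/-- The weight `w_{k,n} B(k + 1, d / 2)`, with `B` the Beta function. -/
noncomputable def wBeta (a : ℝ) (d n k : ℕ) : ℝ :=
  wCoeff a d n k * ProbabilityTheory.beta ((k : ℝ) + 1) ((d : ℝ) / 2)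

/-- The difference `ψ₀(d / 2) - ψ₀(k + 1)`. -/
noncomputable def psiDiff (d k : ℕ) : ℝ := psiZero ((d : ℝ) / 2) - psiZero ((k : ℝ) + 1)

/-- `m_n = ∑_k w_{k,n} (ψ₀(d/2) - ψ₀(k+1)) B(k+1, d/2) + log 2 - γ`. -/
noncomputable def mSeries (a : ℝ) (d n : ℕ) : ℝ :=
  (∑' k : ℕ, psiDiff d k * wBeta a d n k) + (Real.log 2 - Real.eulerMascheroniConstant)

/-- `v_n = ψ₁(d/2) + ∑_k (ψ₁(k+1) - ψ₁(1)) w_{k,n} B(k+1, d/2)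
  + ∑_k (ψ₀(d/2) - ψ₀(k+1))² w_{k,n} B(k+1, d/2)
  - (∑_k (ψ₀(d/2) - ψ₀(k+1)) w_{k,n} B(k+1, d/2))²`. -/
noncomputable def vSeries (a : ℝ) (d n : ℕ) : ℝ :=
  psiOne ((d : ℝ) / 2)
    + (∑' k : ℕ, (psiOne ((k : ℝ) + 1) - psiOne 1) * wBeta a d n k)
    + (∑' k : ℕ, psiDiff d k ^ 2 * wBeta a d n k)
    - (∑' k : ℕ, psiDiff d k * wBeta a d n k) ^ 2

/-- `μ_a(σ) = log σ + (1/2) ∑_{n=0}^d p_d(n) m_n`. -/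
noncomputable def lyapunovExponent (a σ : ℝ) (d : ℕ) : ℝ :=
  Real.log σ + 1 / 2 * ∑ n ∈ Finset.range (d + 1), binomWeight d n * mSeries a d n

/-- `s_a² = (1/4) [∑ p_d(n) v_n + ∑ p_d(n) m_n² - (∑ p_d(n) m_n)²]`, sums over `0 ≤ n ≤ d`. -/
noncomputable def limitVariance (a : ℝ) (d : ℕ) : ℝ :=
  1 / 4 * ((∑ n ∈ Finset.range (d + 1), binomWeight d n * vSeries a d n)
    + (∑ n ∈ Finset.range (d + 1), binomWeight d n * mSeries a d n ^ 2)
    - (∑ n ∈ Finset.range (d + 1), binomWeight d n * mSeries a d n) ^ 2)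

open MeasureTheory ProbabilityTheory Filter Set
open scoped ENNReal Topology

/-! ### The Gamma function and its logarithmic derivatives -/

/-! If `x ≠ 0` and `W` has i.i.d. `N(0, σ²)` entries, then `W x / (σ ‖x‖)` is a standard Gaussian
vector whatever `x` is (`map_sum_mul_gaussianReal`). As `φ_a` is positively homogeneous, each layer
multiplies the squared norm by `2 σ² Q` with `Q = ∑ φ_a(Z_i)² / 2`, whose law `halfSqLaw` does not
depend on the input. A conditional law that does not depend on the past means independence of the
past (`measure_inter_preimage_of_indep`), so `log ‖x^(k)‖` is `log ‖x₀‖` plus a sum of i.i.d. terms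
`log σ + (log 2 + log Q) / 2`. The strong law and the central limit theorem give the limits; the
density comes from convolving with the absolutely continuous law of one increment.

It remains to express the first two moments of `log Q` by the series. Let `E` be a standard
exponential variable independent of `Q`. Then `E / Q` has density `y ↦ 𝔼[Q exp(-yQ)]`, minus the
derivative of the Laplace transform of `Q`, which is explicit. Expanding it first by the binomial
theorem and then by the binomial series exhibits the law of `E / Q` as a mixture of beta prime laws
with weights `p_d(n) w_{k,n}` (`map_div_halfSqLaw_prod_stdExp`). Logarithmic moments of beta prime
and exponential laws are digamma and trigamma expressions, and `log (E / Q) = log E - log Q`; this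
yields `lyapunovExponent_eq` and `limitVariance_eq`. Summability comes with it, from integrability
against the mixture. -/

lemma analyticAt_realGamma {x : ℝ} (hx : 0 < x) : AnalyticAt ℝ Real.Gamma x := by
  have hC : AnalyticAt ℂ Complex.Gamma (x : ℂ) := by
    -- Analyticity, not just differentiability, is wanted: `psiZero` contains `deriv Real.Gamma` and
    -- is differentiated again.
    rw [Complex.analyticAt_iff_eventually_differentiableAt]
    have : ∀ᶠ z : ℂ in 𝓝 (x : ℂ), 0 < z.re :=
      (isOpen_lt continuous_const Complex.continuous_re).mem_nhds (by simpa using hx)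
    filter_upwards [this] with z hz
    refine Complex.differentiableAt_Gamma z fun m h => ?_
    rw [h] at hz
    simp only [Complex.neg_re, Complex.natCast_re] at hz
    linarith [(Nat.cast_nonneg m : (0 : ℝ) ≤ m)]
  refine hC.re_ofReal.congr (Eventually.of_forall fun y => ?_)
  simp [Complex.Gamma_ofReal]

lemma hasDerivAt_realGamma {x : ℝ} (hx : 0 < x) :
    HasDerivAt Real.Gamma (Real.Gamma x * psiZero x) x := by
  have h := (analyticAt_realGamma hx).differentiableAt.hasDerivAt
  have h0 := (Real.Gamma_pos_of_pos hx).ne'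
  have e : Real.Gamma x * psiZero x = deriv Real.Gamma x := by
    unfold psiZero
    field_simp
  rwa [e]

lemma hasDerivAt_psiZero {x : ℝ} (hx : 0 < x) : HasDerivAt psiZero (psiOne x) x := by
  have h : DifferentiableAt ℝ psiZero x :=
    (analyticAt_realGamma hx).deriv.differentiableAt.div
      (analyticAt_realGamma hx).differentiableAt (Real.Gamma_pos_of_pos hx).ne'
  exact h.hasDerivAt

lemma psiZero_one : psiZero 1 = -Real.eulerMascheroniConstant := by
  simp [psiZero, Real.hasDerivAt_Gamma_one.deriv]

/-! ### Moments from the moment generating function -/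

/-- First two moments of a random variable whose moment generating function has logarithmic
derivative `φ` near `0`. -/
lemma moments_of_mgf_eventuallyEq {Ω : Type*} [MeasurableSpace Ω] {μ : Measure Ω} {X : Ω → ℝ}
    {G φ : ℝ → ℝ} {φ' : ℝ}
    (hint : ∀ᶠ s in 𝓝 (0 : ℝ), Integrable (fun ω => Real.exp (s * X ω)) μ)
    (hmgf : ∀ᶠ s in 𝓝 (0 : ℝ), mgf X μ s = G s)
    (hG : ∀ᶠ s in 𝓝 (0 : ℝ), HasDerivAt G (G s * φ s) s) (hφ : HasDerivAt φ φ' 0) :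
    Integrable X μ ∧ Integrable (fun ω => X ω ^ 2) μ ∧
      ∫ ω, X ω ∂μ = G 0 * φ 0 ∧ ∫ ω, X ω ^ 2 ∂μ = G 0 * (φ 0 ^ 2 + φ') := by
  have h0 : (0 : ℝ) ∈ interior (integrableExpSet X μ) := mem_interior_iff_mem_nhds.2 hint
  have e0 : mgf X μ =ᶠ[𝓝 0] G := hmgf
  have e1 : deriv (mgf X μ) =ᶠ[𝓝 0] fun s => G s * φ s := by
    filter_upwards [e0.eventuallyEq_nhds, hG] with s hs hs'
    rw [hs.deriv_eq, hs'.deriv]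
  have m1 := iteratedDeriv_mgf_zero h0 1
  have m2 := iteratedDeriv_mgf_zero h0 2
  rw [iteratedDeriv_one, e1.self_of_nhds] at m1
  -- From `G' = G φ` near `0` follows `G'' = G (φ² + φ')` at `0`. The measure need not be a
  -- probability: `G 0` is its mass.
  rw [iteratedDeriv_succ, iteratedDeriv_one, e1.deriv_eq, (hG.self_of_nhds.fun_mul hφ).deriv] at m2
  refine ⟨?_, ?_, ?_, ?_⟩
  · simpa using integrable_pow_of_mem_interior_integrableExpSet h0 1
  · exact integrable_pow_of_mem_interior_integrableExpSet h0 2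
  · simpa using m1.symm
  · calc ∫ ω, X ω ^ 2 ∂μ = _ := m2.symm
      _ = _ := by ring

lemma integrable_and_integral_of_lintegral_ofReal {Ω : Type*} [MeasurableSpace Ω] {μ : Measure Ω}
    {f : Ω → ℝ} {c : ℝ} (hf : AEStronglyMeasurable f μ) (h0 : 0 ≤ᵐ[μ] f) (hc : 0 ≤ c)
    (h : ∫⁻ ω, ENNReal.ofReal (f ω) ∂μ = ENNReal.ofReal c) :
    Integrable f μ ∧ ∫ ω, f ω ∂μ = c := by
  refine ⟨(lintegral_ofReal_ne_top_iff_integrable hf h0).1 (by simp [h]), ?_⟩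
  rw [integral_eq_lintegral_of_nonneg_ae h0 hf, h, ENNReal.toReal_ofReal hc]

/-! ### Gamma and beta prime integrals -/

lemma lintegral_rpow_mul_exp_neg_mul {p r : ℝ} (hp : 0 < p) (hr : 0 < r) :
    ∫⁻ t in Ioi (0 : ℝ), ENNReal.ofReal (t ^ (p - 1) * Real.exp (-(r * t)))
      = ENNReal.ofReal ((1 / r) ^ p * Real.Gamma p) := by
  rw [← Real.integral_rpow_mul_exp_neg_mul_Ioi hp hr, ofReal_integral_eq_lintegral_ofReal]
  · have hne : (∫ t in Ioi (0 : ℝ), t ^ (p - 1) * Real.exp (-(r * t))) ≠ 0 := by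
      rw [Real.integral_rpow_mul_exp_neg_mul_Ioi hp hr]
      have := Real.Gamma_pos_of_pos hp
      positivity
    exact Integrable.of_integral_ne_zero hne
  · refine (ae_restrict_iff' measurableSet_Ioi).2 (ae_of_all _ fun t (ht : 0 < t) => ?_)
    positivity

/-- The exponential distribution with rate one. -/
noncomputable def stdExp : Measure ℝ :=
  (volume.restrict (Ioi 0)).withDensity fun t => ENNReal.ofReal (Real.exp (-t))

/-- The (unnormalized) beta prime distribution, of total mass `B(p, q)`. -/
noncomputable def betaPrime (p q : ℝ) : Measure ℝ :=
  (volume.restrict (Ioi 0)).withDensity fun y =>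
    ENNReal.ofReal (y ^ (p - 1) * (1 + y) ^ (-(p + q)))

/-- Write `Γ(p+q) (1+y)^(-(p+q))` as `∫ x^(p+q-1) exp(-(1+y)x) dx` and swap by Tonelli: the
`y`-integral gives `Γ(p) x^(-p)`, and the remaining `x`-integral is `Γ(q)`. -/
lemma lintegral_betaPrime_density {p q : ℝ} (hp : 0 < p) (hq : 0 < q) :
    ∫⁻ y in Ioi (0 : ℝ), ENNReal.ofReal (y ^ (p - 1) * (1 + y) ^ (-(p + q)))
      = ENNReal.ofReal (beta p q) := by
  have hG := Real.Gamma_pos_of_pos (add_pos hp hq)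
  have hGp := Real.Gamma_pos_of_pos hp
  have key : ENNReal.ofReal (Real.Gamma (p + q)) *
      ∫⁻ y in Ioi (0 : ℝ), ENNReal.ofReal (y ^ (p - 1) * (1 + y) ^ (-(p + q)))
      = ENNReal.ofReal (Real.Gamma p * Real.Gamma q) := by
    calc _ = ∫⁻ y in Ioi (0 : ℝ), ∫⁻ x in Ioi (0 : ℝ), ENNReal.ofReal
          (y ^ (p - 1) * (x ^ (p + q - 1) * Real.exp (-((1 + y) * x)))) := by
          rw [← lintegral_const_mul _ (by fun_prop)]
          refine setLIntegral_congr_fun measurableSet_Ioi fun y (hy : 0 < y) => ?_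
          rw [← ENNReal.ofReal_mul hG.le]
          have : ∀ x, ENNReal.ofReal
              (y ^ (p - 1) * (x ^ (p + q - 1) * Real.exp (-((1 + y) * x)))) =
              ENNReal.ofReal (y ^ (p - 1)) *
                ENNReal.ofReal (x ^ (p + q - 1) * Real.exp (-((1 + y) * x))) :=
            fun x => ENNReal.ofReal_mul (by positivity)
          simp_rw [this]
          rw [lintegral_const_mul _ (by fun_prop),
            lintegral_rpow_mul_exp_neg_mul (add_pos hp hq) (by positivity),
            ← ENNReal.ofReal_mul (by positivity), one_div, Real.inv_rpow (by positivity),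
            ← Real.rpow_neg (by positivity)]
          congr 1
          ring
      _ = ∫⁻ x in Ioi (0 : ℝ), ∫⁻ y in Ioi (0 : ℝ), ENNReal.ofReal
          (y ^ (p - 1) * (x ^ (p + q - 1) * Real.exp (-((1 + y) * x)))) := by
          rw [lintegral_lintegral_swap]
          exact Measurable.aemeasurable (by unfold Function.uncurry; fun_prop)
      _ = ∫⁻ x in Ioi (0 : ℝ), ENNReal.ofReal (Real.Gamma p) *
            ENNReal.ofReal (x ^ (q - 1) * Real.exp (-(1 * x))) := by
          refine setLIntegral_congr_fun measurableSet_Ioi fun x (hx : 0 < x) => ?_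
          have : ∀ y, ENNReal.ofReal
              (y ^ (p - 1) * (x ^ (p + q - 1) * Real.exp (-((1 + y) * x)))) =
              ENNReal.ofReal (x ^ (p + q - 1) * Real.exp (-x)) *
                ENNReal.ofReal (y ^ (p - 1) * Real.exp (-(x * y))) := fun y => by
            rw [← ENNReal.ofReal_mul (by positivity),
              show -((1 + y) * x) = -x + -(x * y) by ring, Real.exp_add]
            congr 1
            ring
          simp_rw [this]
          rw [lintegral_const_mul _ (by fun_prop), lintegral_rpow_mul_exp_neg_mul hp hx,
            ← ENNReal.ofReal_mul (by positivity), ← ENNReal.ofReal_mul (by positivity), one_div,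
            Real.inv_rpow hx.le, show p + q - 1 = p + (q - 1) by ring, Real.rpow_add hx]
          congr 1
          have := (Real.rpow_pos_of_pos hx p).ne'
          field_simp
      _ = _ := by
          rw [lintegral_const_mul _ (by fun_prop), lintegral_rpow_mul_exp_neg_mul hq one_pos,
            ← ENNReal.ofReal_mul hGp.le]
          simp
  rw [beta, ENNReal.ofReal_div_of_pos hG, ← key, mul_comm, mul_div_assoc,
    ENNReal.div_self (by simpa using hG) (by simp), mul_one]

/-- The factor `y ^ s` turns the density with parameters `(p, q)` into the one with parameters `(p +
s, q - s)`. -/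
lemma lintegral_exp_mul_log_betaPrime {p q s : ℝ} (hp : 0 < p + s) (hq : 0 < q - s) :
    ∫⁻ y, ENNReal.ofReal (Real.exp (s * Real.log y)) ∂(betaPrime p q)
      = ENNReal.ofReal (beta (p + s) (q - s)) := by
  rw [betaPrime, lintegral_withDensity_eq_lintegral_mul _ (by fun_prop) (by fun_prop),
    ← lintegral_betaPrime_density hp hq]
  refine setLIntegral_congr_fun measurableSet_Ioi fun y (hy : 0 < y) => ?_
  simp only [Pi.mul_apply]
  rw [← ENNReal.ofReal_mul (by positivity), mul_comm s, ← Real.rpow_def_of_pos hy,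
    show p + s - 1 = (p - 1) + s by ring, Real.rpow_add hy, show p + s + (q - s) = p + q by ring]
  congr 1
  ring

lemma lintegral_exp_mul_log_stdExp {s : ℝ} (hs : 0 < 1 + s) :
    ∫⁻ y, ENNReal.ofReal (Real.exp (s * Real.log y)) ∂stdExp
      = ENNReal.ofReal (Real.Gamma (1 + s)) := by
  have h := lintegral_rpow_mul_exp_neg_mul hs one_pos
  rw [stdExp, lintegral_withDensity_eq_lintegral_mul _ (by fun_prop) (by fun_prop)]
  rw [one_div_one, Real.one_rpow, one_mul] at h
  rw [← h]
  refine setLIntegral_congr_fun measurableSet_Ioi fun y (hy : 0 < y) => ?_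
  simp only [Pi.mul_apply]
  rw [← ENNReal.ofReal_mul (by positivity), mul_comm s, ← Real.rpow_def_of_pos hy]
  simp [mul_comm]

lemma moments_log_stdExp :
    Integrable Real.log stdExp ∧ Integrable (fun y => Real.log y ^ 2) stdExp ∧
      ∫ y, Real.log y ∂stdExp = psiZero 1 ∧
      ∫ y, Real.log y ^ 2 ∂stdExp = psiZero 1 ^ 2 + psiOne 1 := by
  have hev : ∀ᶠ s in 𝓝 (0 : ℝ), 0 < 1 + s :=
    (isOpen_lt continuous_const (by fun_prop)).mem_nhds (by simp)
  have key : ∀ s : ℝ, 0 < 1 + s → _ := fun s hs =>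
    integrable_and_integral_of_lintegral_ofReal (μ := stdExp)
      (f := fun y => Real.exp (s * Real.log y)) (by fun_prop)
      (ae_of_all _ fun y => (Real.exp_pos _).le) (Real.Gamma_pos_of_pos hs).le
      (lintegral_exp_mul_log_stdExp hs)
  have := moments_of_mgf_eventuallyEq (μ := stdExp) (X := Real.log)
    (G := fun s => Real.Gamma (1 + s)) (φ := fun s => psiZero (1 + s)) (φ' := psiOne 1)
    (by filter_upwards [hev] with s hs using (key s hs).1)
    (by filter_upwards [hev] with s hs using (key s hs).2)
    (by filter_upwards [hev] with s hs using (hasDerivAt_realGamma hs).comp_const_add 1 s)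
    (by simpa using (hasDerivAt_psiZero (x := 1 + 0) (by simp)).comp_const_add 1 0)
  simpa using this

lemma moments_log_betaPrime {p q : ℝ} (hp : 0 < p) (hq : 0 < q) :
    Integrable Real.log (betaPrime p q) ∧ Integrable (fun y => Real.log y ^ 2) (betaPrime p q) ∧
      ∫ y, Real.log y ∂(betaPrime p q) = beta p q * (psiZero p - psiZero q) ∧
      ∫ y, Real.log y ^ 2 ∂(betaPrime p q)
        = beta p q * ((psiZero p - psiZero q) ^ 2 + (psiOne p + psiOne q)) := by
  have hev : ∀ᶠ s in 𝓝 (0 : ℝ), 0 < p + s ∧ 0 < q - s :=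
    (continuousAt_const.eventually_lt (f := fun _ => (0 : ℝ)) (g := fun s => p + s)
      (by fun_prop) (by simpa)).and
    (continuousAt_const.eventually_lt (f := fun _ => (0 : ℝ)) (g := fun s => q - s)
      (by fun_prop) (by simpa))
  have key : ∀ s : ℝ, (0 < p + s ∧ 0 < q - s) → _ := fun s hs =>
    integrable_and_integral_of_lintegral_ofReal (μ := betaPrime p q)
      (f := fun y => Real.exp (s * Real.log y)) (by fun_prop)
      (ae_of_all _ fun y => (Real.exp_pos _).le) (beta_pos hs.1 hs.2).le
      (lintegral_exp_mul_log_betaPrime hs.1 hs.2)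
  have hd (s : ℝ) (hs : 0 < p + s ∧ 0 < q - s) :
      HasDerivAt (fun s => beta (p + s) (q - s))
        (beta (p + s) (q - s) * (psiZero (p + s) - psiZero (q - s))) s := by
    have h := (((hasDerivAt_realGamma hs.1).comp_const_add p s).mul
      ((hasDerivAt_realGamma hs.2).comp_const_sub q s)).div_const (Real.Gamma (p + q))
    have e : (fun s => beta (p + s) (q - s))
        = fun s => Real.Gamma (p + s) * Real.Gamma (q - s) / Real.Gamma (p + q) := by
      ext s; simp only [beta]; congr 2; ring
    rw [e]
    refine h.congr_deriv ?_
    unfold beta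
    rw [show p + s + (q - s) = p + q by ring]
    ring
  have := moments_of_mgf_eventuallyEq (μ := betaPrime p q) (X := Real.log)
    (G := fun s => beta (p + s) (q - s)) (φ := fun s => psiZero (p + s) - psiZero (q - s))
    (φ' := psiOne p + psiOne q)
    (by filter_upwards [hev] with s hs using (key s hs).1)
    (by filter_upwards [hev] with s hs using (key s hs).2)
    (by filter_upwards [hev] with s hs using hd s hs)
    (by
      have h1 := (hasDerivAt_psiZero (x := p + 0) (by simpa)).comp_const_add p 0
      have h2 := (hasDerivAt_psiZero (x := q - 0) (by simpa)).comp_const_sub q 0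
      simpa using h1.fun_sub h2)
  simpa using this

instance : IsProbabilityMeasure stdExp := by
  constructor
  have := lintegral_exp_mul_log_stdExp (s := 0) (by simp)
  simpa using this

lemma betaPrime_univ {p q : ℝ} (hp : 0 < p) (hq : 0 < q) :
    betaPrime p q univ = ENNReal.ofReal (beta p q) := by
  have := lintegral_exp_mul_log_betaPrime (s := 0) (p := p) (q := q) (by simpa) (by simpa)
  simpa using this

/-! ### The quotient of a standard exponential variable by a positive variable -/

lemma lintegral_comp_div_stdExp {q : ℝ} (hq : 0 < q) {f : ℝ → ℝ≥0∞} (hf : Measurable f) :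
    ∫⁻ x, f (x / q) ∂stdExp
      = ∫⁻ y in Ioi (0 : ℝ), ENNReal.ofReal (q * Real.exp (-(y * q))) * f y := by
  rw [stdExp, lintegral_withDensity_eq_lintegral_mul _ (by fun_prop) (by fun_prop)]
  have him : (fun y : ℝ => q * y) '' Ioi 0 = Ioi 0 := by
    rw [image_mul_left_Ioi hq, mul_zero]
  have := lintegral_image_eq_lintegral_abs_deriv_mul (s := Ioi (0 : ℝ)) (f := fun y => q * y)
    (f' := fun _ => q) measurableSet_Ioi
    (fun x _ => by simpa using (hasDerivAt_id x).hasDerivWithinAt.const_mul q)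
    (mul_right_injective₀ hq.ne').injOn
    ((fun t => ENNReal.ofReal (Real.exp (-t))) * fun x => f (x / q))
  rw [him] at this
  rw [this]
  refine lintegral_congr fun y => ?_
  simp only [Pi.mul_apply, abs_of_pos hq]
  rw [← mul_assoc, ← ENNReal.ofReal_mul hq.le, mul_div_cancel_left₀ _ hq.ne', mul_comm q y]

/-- Given `Q = q`, the quotient `E / q` is exponential with rate `q`; averaging over `q` gives the
density. This brings in the Laplace transform of `Q`, which is computable although the law of `Q` is
not explicit. -/
lemma map_div_prod_stdExp {κ : Measure ℝ} [SFinite κ] (hκ : ∀ᵐ q ∂κ, 0 < q) :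
    (κ.prod stdExp).map (fun p => p.2 / p.1)
      = (volume.restrict (Ioi 0)).withDensity
          fun y => ∫⁻ q, ENNReal.ofReal (q * Real.exp (-(y * q))) ∂κ := by
  refine Measure.ext_of_lintegral _ fun f hf => ?_
  rw [lintegral_map hf (by fun_prop), lintegral_prod _ (by fun_prop),
    lintegral_withDensity_eq_lintegral_mul _
      (Measurable.lintegral_prod_right (f := fun y : ℝ => fun q : ℝ =>
        ENNReal.ofReal (q * Real.exp (-(y * q)))) (by unfold Function.uncurry; fun_prop)) hf]
  calc _ = ∫⁻ q, (∫⁻ y in Ioi (0 : ℝ), ENNReal.ofReal (q * Real.exp (-(y * q))) * f y) ∂κ :=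
        lintegral_congr_ae (hκ.mono fun q hq => lintegral_comp_div_stdExp hq hf)
    _ = ∫⁻ y in Ioi (0 : ℝ), (∫⁻ q, ENNReal.ofReal (q * Real.exp (-(y * q))) * f y ∂κ) := by
        rw [lintegral_lintegral_swap]
        exact Measurable.aemeasurable (by unfold Function.uncurry; fun_prop)
    _ = _ := by
        refine lintegral_congr fun y => ?_
        rw [lintegral_mul_const _ (by fun_prop)]
        rfl

/-! ### The binomial expansion -/

lemma hasSum_choose_mul_pow (β : ℝ) {x : ℝ} (hx : |x| < 1) :
    HasSum (fun k : ℕ => Ring.choose (β + k - 1) k * x ^ k) ((1 - x) ^ (-β)) := by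
  have h := (Real.one_div_one_sub_rpow_hasFPowerSeriesOnBall_zero β).hasSum (y := x)
    (by simpa [Metric.eball, edist_dist, enorm_eq_nnnorm] using hx)
  rw [zero_add, one_div, ← Real.rpow_neg (by linarith [(abs_lt.1 hx).2])] at h
  simpa [FormalMultilinearSeries.ofScalars_apply_eq, mul_comm] using h

lemma choose_add_sub_one_nonneg {β : ℝ} (hβ : 0 ≤ β) (k : ℕ) :
    0 ≤ Ring.choose (β + k - 1) k := by
  rw [← Ring.multichoose_eq]
  have h := Ring.factorial_nsmul_multichoose_eq_ascPochhammer β k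
  rw [Polynomial.ascPochhammer_smeval_eq_eval] at h
  have h2 : 0 ≤ (ascPochhammer ℝ k).eval β := by
    rcases hβ.eq_or_lt with rfl | hβ
    · rw [ascPochhammer_eval_zero]; split_ifs <;> simp
    · exact (ascPochhammer_pos k β hβ).le
  rw [← h, nsmul_eq_mul] at h2
  exact nonneg_of_mul_nonneg_right h2 (by positivity)

/-- Nonnegativity makes the coefficients weights of a mixture of measures, so that sums and
integrals are exchanged without estimates. -/
lemma wCoeff_nonneg {a : ℝ} (ha : a ∈ Ioc (0 : ℝ) 1) {d n : ℕ} (hn : n ≤ d) (k : ℕ) :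
    0 ≤ wCoeff a d n k := by
  have hβ : (0 : ℝ) ≤ ((d : ℝ) - n) / 2 := by
    have : (n : ℝ) ≤ d := by exact_mod_cast hn
    linarith
  have h1 := choose_add_sub_one_nonneg hβ k
  have h2 := choose_add_sub_one_nonneg (β := ((d : ℝ) - n) / 2 + 1) (by linarith) k
  rw [show ((d : ℝ) - n) / 2 + 1 + k - 1 = ((d : ℝ) - n) / 2 + k by ring] at h2
  have hc : 0 ≤ 1 - a ^ 2 := by nlinarith [ha.1, ha.2]
  have hd : (0 : ℝ) ≤ (d : ℝ) - n := by linarith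
  unfold wCoeff
  positivity

/-- With `x = (1 - a²) y / (1 + y)` one has `1 + a² y = (1 + y)(1 - x)` and `0 ≤ x < 1`, so negative
powers of `1 + a² y` expand in powers of `x`. Up to constants, `x ^ k (1 + y)^(-d/2 - 1)` is the
beta prime density with parameters `(k + 1, d/2)`. -/
lemma hasSum_wCoeff {a : ℝ} (ha : a ∈ Ioc (0 : ℝ) 1) (d n : ℕ) {y : ℝ} (hy : 0 < y) :
    HasSum (fun k : ℕ => wCoeff a d n k *
        (y ^ ((k : ℝ) + 1 - 1) * (1 + y) ^ (-((k : ℝ) + 1 + (d : ℝ) / 2))))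
      ((n : ℝ) / 2 * (1 + y) ^ (-((n : ℝ) / 2) - 1) * (1 + a ^ 2 * y) ^ (-(((d : ℝ) - n) / 2))
        + a ^ 2 * (((d : ℝ) - n) / 2) * (1 + y) ^ (-((n : ℝ) / 2))
          * (1 + a ^ 2 * y) ^ (-(((d : ℝ) - n) / 2) - 1)) := by
  have hc0 : 0 ≤ 1 - a ^ 2 := by nlinarith [ha.1, ha.2]
  have ha2 : 0 < a ^ 2 := by have := ha.1; positivity
  have hy1 : 0 < 1 + y := by linarith
  have hay : 0 < 1 + a ^ 2 * y := by positivity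
  set x : ℝ := (1 - a ^ 2) * (y / (1 + y)) with hxdef
  have h1x : 1 - x = (1 + a ^ 2 * y) / (1 + y) := by rw [hxdef]; field_simp; ring
  have hx : |x| < 1 := by
    rw [abs_of_nonneg (by positivity)]
    have : 0 < 1 - x := by rw [h1x]; positivity
    linarith
  set β : ℝ := ((d : ℝ) - n) / 2 with hβ
  have hd : (d : ℝ) / 2 = n / 2 + β := by rw [hβ]; ring
  have e1 : (1 - x) ^ (-β) = (1 + a ^ 2 * y) ^ (-β) * (1 + y) ^ β := by
    rw [h1x, Real.div_rpow hay.le hy1.le, Real.rpow_neg hy1.le, div_inv_eq_mul]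
  have e2 : (1 - x) ^ (-(β + 1)) = (1 + a ^ 2 * y) ^ (-β - 1) * (1 + y) ^ (β + 1) := by
    rw [h1x, Real.div_rpow hay.le hy1.le, Real.rpow_neg hy1.le (β + 1), div_inv_eq_mul]
    congr 2
    ring
  -- The two terms of the limit need the exponents `β` and `β + 1`; hence the two binomial
  -- coefficients in `wCoeff`.
  have s := ((hasSum_choose_mul_pow β hx).mul_left ((n : ℝ) / 2 * (1 + y) ^ (-((d : ℝ) / 2) - 1))).add
    ((hasSum_choose_mul_pow (β + 1) hx).mul_left (a ^ 2 * β * (1 + y) ^ (-((d : ℝ) / 2) - 1)))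
  have r1 : (1 + y) ^ (-((d : ℝ) / 2) - 1) * (1 + y) ^ β = (1 + y) ^ (-((n : ℝ) / 2) - 1) := by
    rw [← Real.rpow_add hy1]; congr 1; rw [hd]; ring
  have r2 : (1 + y) ^ (-((d : ℝ) / 2) - 1) * (1 + y) ^ (β + 1) = (1 + y) ^ (-((n : ℝ) / 2)) := by
    rw [← Real.rpow_add hy1]; congr 1; rw [hd]; ring
  convert! s using 1
  · ext k
    have r3 : (1 + y) ^ (-((k : ℝ) + 1 + (d : ℝ) / 2))
        = (1 + y) ^ (-((d : ℝ) / 2) - 1) * ((1 + y) ^ k)⁻¹ := by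
      rw [← Real.rpow_natCast, ← Real.rpow_neg hy1.le, ← Real.rpow_add hy1]; congr 1; ring
    rw [r3, show (k : ℝ) + 1 - 1 = k by ring, Real.rpow_natCast, wCoeff, ← hβ,
      show β + 1 + k - 1 = β + k by ring, hxdef, mul_pow, div_pow,
      show (d : ℝ) - n = 2 * β by rw [hβ]; ring]
    have : (1 + y) ^ k ≠ 0 := by positivity
    field_simp
  · rw [e1, e2, ← r1, ← r2]
    ring

/-! ### The law of half the squared norm of the activated standard Gaussian vector -/

lemma prelu_sq (a z : ℝ) : prelu a z ^ 2 = if 0 < z then z ^ 2 else a ^ 2 * z ^ 2 := by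
  unfold prelu
  split_ifs <;> ring

@[fun_prop]
lemma measurable_prelu (a : ℝ) : Measurable (prelu a) :=
  Measurable.ite measurableSet_Ioi measurable_id (measurable_const.mul measurable_id)

@[fun_prop]
lemma measurable_sum_prelu_sq (a : ℝ) {d : ℕ} :
    Measurable fun z : Fin d → ℝ => ∑ i, prelu a (z i) ^ 2 / 2 := by fun_prop

/-- The law of `∑ φ_a(Z_i)² / 2` for a standard Gaussian vector `Z`. -/
noncomputable def halfSqLaw (a : ℝ) (d : ℕ) : Measure ℝ :=
  (Measure.pi fun _ : Fin d => gaussianReal 0 1).map fun z => ∑ i, prelu a (z i) ^ 2 / 2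

instance (a : ℝ) (d : ℕ) : IsProbabilityMeasure (halfSqLaw a d) :=
  Measure.isProbabilityMeasure_map (measurable_sum_prelu_sq a).aemeasurable

/-- Each half-line carries half of a centred Gaussian integral, with `y` scaled by `1` on the right
and by `a²` on the left. -/
lemma mgf_prelu_sq_gaussianReal (a : ℝ) {y : ℝ} (hy : 0 < y) :
    mgf (fun z => prelu a z ^ 2 / 2) (gaussianReal 0 1) (-y)
      = ((1 + y) ^ (-(1 / 2 : ℝ)) + (1 + a ^ 2 * y) ^ (-(1 / 2 : ℝ))) / 2 := by
  have hint : Integrable (fun x => gaussianPDFReal 0 1 x • Real.exp (-y * (prelu a x ^ 2 / 2))) := by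
    refine (integrable_gaussianPDFReal 0 1).mono (by fun_prop) (ae_of_all _ fun x => ?_)
    rw [smul_eq_mul, norm_mul, Real.norm_of_nonneg (Real.exp_pos _).le]
    refine mul_le_of_le_one_right (norm_nonneg _) (Real.exp_le_one_iff.2 ?_)
    have : 0 ≤ prelu a x ^ 2 := sq_nonneg _
    nlinarith
  have half (c : ℝ) (hc : 0 ≤ c) : ∫ x in Ioi (0 : ℝ), (√(2 * Real.pi))⁻¹ * Real.exp (-((1 + c * y) / 2) * x ^ 2)
      = (1 + c * y) ^ (-(1 / 2 : ℝ)) / 2 := by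
    have h1 : 0 < 1 + c * y := by positivity
    rw [integral_const_mul, integral_gaussian_Ioi, Real.rpow_neg h1.le, ← Real.sqrt_eq_rpow,
      show Real.pi / ((1 + c * y) / 2) = (2 * Real.pi) / (1 + c * y) by field_simp,
      Real.sqrt_div (by positivity)]
    have : √(2 * Real.pi) ≠ 0 := by positivity
    field_simp
  rw [mgf, integral_gaussianReal_eq_integral_smul one_ne_zero,
    ← integral_add_compl measurableSet_Ioi hint, compl_Ioi]
  have e1 : ∫ x in Ioi (0 : ℝ), gaussianPDFReal 0 1 x • Real.exp (-y * (prelu a x ^ 2 / 2))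
      = (1 + y) ^ (-(1 / 2 : ℝ)) / 2 := by
    have := half 1 zero_le_one
    rw [one_mul] at this
    rw [← this]
    refine setIntegral_congr_fun measurableSet_Ioi fun x (hx : 0 < x) => ?_
    simp only [prelu_sq, if_pos hx, gaussianPDFReal, smul_eq_mul, mul_assoc, ← Real.exp_add]
    norm_num
    left
    ring
  have e2 : ∫ x in Iic (0 : ℝ), gaussianPDFReal 0 1 x • Real.exp (-y * (prelu a x ^ 2 / 2))
      = (1 + a ^ 2 * y) ^ (-(1 / 2 : ℝ)) / 2 := by
    rw [← half (a ^ 2) (sq_nonneg a), ← neg_zero, ← integral_comp_neg_Iic, neg_zero]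
    refine setIntegral_congr_fun measurableSet_Iic fun x (hx : x ≤ 0) => ?_
    simp only [prelu_sq, if_neg hx.not_gt, gaussianPDFReal, smul_eq_mul, mul_assoc, ← Real.exp_add]
    norm_num
    left
    ring
  rw [e1, e2]
  ring

/-- Independence gives the `d`-th power of the one-coordinate transform. In its binomial expansion
`n` is the number of positive coordinates. -/
lemma mgf_id_halfSqLaw (a : ℝ) (d : ℕ) {y : ℝ} (hy : 0 < y) :
    mgf id (halfSqLaw a d) (-y)
      = ∑ n ∈ Finset.range (d + 1), binomWeight d n *
        ((1 + y) ^ (-((n : ℝ) / 2)) * (1 + a ^ 2 * y) ^ (-(((d : ℝ) - n) / 2))) := by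
  have h1 : 0 < 1 + y := by linarith
  have h2 : 0 < 1 + a ^ 2 * y := by positivity
  have hind := iIndepFun_pi (μ := fun _ : Fin d => gaussianReal 0 1)
    (X := fun _ z => prelu a z ^ 2 / 2) (fun i => by fun_prop)
  have hsum := hind.mgf_sum (t := -y) (fun i => by fun_prop) Finset.univ
  have e : (fun z : Fin d → ℝ => ∑ i, prelu a (z i) ^ 2 / 2)
      = ∑ i, fun z : Fin d → ℝ => prelu a (z i) ^ 2 / 2 := by ext; simp
  rw [halfSqLaw, mgf_id_map (measurable_sum_prelu_sq a).aemeasurable, e, hsum]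
  have hi (i : Fin d) : mgf (fun z : Fin d → ℝ => prelu a (z i) ^ 2 / 2)
      (Measure.pi fun _ : Fin d => gaussianReal 0 1) (-y)
      = ((1 + y) ^ (-(1 / 2 : ℝ)) + (1 + a ^ 2 * y) ^ (-(1 / 2 : ℝ))) / 2 := by
    have hm := measurePreserving_eval (fun _ : Fin d => gaussianReal 0 1) i
    have h := integral_map (μ := Measure.pi fun _ : Fin d => gaussianReal 0 1) (f := fun z => Real.exp (-y * (prelu a z ^ 2 / 2)))
      hm.measurable.aemeasurable (by fun_prop)
    rw [hm.map_eq] at h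
    rw [← mgf_prelu_sq_gaussianReal a hy, mgf, mgf, h]
  rw [Finset.prod_congr rfl fun i _ => hi i, Finset.prod_const, Finset.card_univ, Fintype.card_fin,
    div_pow, add_pow, Finset.sum_div]
  refine Finset.sum_congr rfl fun n hn => ?_
  have hn' : n ≤ d := by simpa [Nat.lt_succ_iff] using hn
  rw [← Real.rpow_natCast, ← Real.rpow_natCast, ← Real.rpow_mul h1.le, ← Real.rpow_mul h2.le,
    Nat.cast_sub hn', binomWeight]
  rw [show -(1 / 2 : ℝ) * n = -((n : ℝ) / 2) by ring,
    show -(1 / 2 : ℝ) * ((d : ℝ) - n) = -(((d : ℝ) - n) / 2) by ring]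
  ring

lemma halfSqLaw_nonneg (a : ℝ) (d : ℕ) : ∀ᵐ q ∂halfSqLaw a d, 0 ≤ q := by
  rw [halfSqLaw, ae_map_iff (measurable_sum_prelu_sq a).aemeasurable measurableSet_Ici]
  exact ae_of_all _ fun z => Finset.sum_nonneg fun i _ => by positivity

lemma ae_pi_gaussianReal_ne_zero {d : ℕ} (i : Fin d) :
    ∀ᵐ z ∂Measure.pi fun _ : Fin d => gaussianReal 0 1, z i ≠ 0 := by
  have := nullSingletonClass_gaussianReal (μ := 0) one_ne_zero
  have h : ∀ᵐ x ∂gaussianReal 0 1, x ≠ 0 := by simp [ae_iff]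
  exact (measurePreserving_eval (fun _ : Fin d => gaussianReal 0 1) i).quasiMeasurePreserving.ae h

lemma sq_mul_sq_le_prelu_sq {a : ℝ} (ha : a ∈ Ioc (0 : ℝ) 1) (z : ℝ) :
    a ^ 2 * z ^ 2 ≤ prelu a z ^ 2 := by
  have : a ^ 2 ≤ 1 := by nlinarith [ha.1, ha.2]
  rw [prelu_sq]
  split_ifs <;> nlinarith [sq_nonneg z]

lemma prelu_sq_le {a : ℝ} (ha : a ∈ Ioc (0 : ℝ) 1) (z : ℝ) : prelu a z ^ 2 ≤ z ^ 2 := by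
  have : a ^ 2 ≤ 1 := by nlinarith [ha.1, ha.2]
  rw [prelu_sq]
  split_ifs <;> nlinarith [sq_nonneg z]

lemma sq_mul_sq_le_sum_prelu_sq {a : ℝ} (ha : a ∈ Ioc (0 : ℝ) 1) {d : ℕ} (z : Fin d → ℝ)
    (i : Fin d) : a ^ 2 * z i ^ 2 / 2 ≤ ∑ i, prelu a (z i) ^ 2 / 2 := by
  refine le_trans ?_ (Finset.single_le_sum (f := fun i => prelu a (z i) ^ 2 / 2)
    (fun i _ => by positivity) (Finset.mem_univ i))
  have := sq_mul_sq_le_prelu_sq ha (z i)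
  linarith

lemma halfSqLaw_pos {a : ℝ} (ha : a ∈ Ioc (0 : ℝ) 1) {d : ℕ} (hd : 0 < d) :
    ∀ᵐ q ∂halfSqLaw a d, 0 < q := by
  rw [halfSqLaw, ae_map_iff (measurable_sum_prelu_sq a).aemeasurable measurableSet_Ioi]
  filter_upwards [ae_pi_gaussianReal_ne_zero ⟨0, hd⟩] with z hz
  refine lt_of_lt_of_le ?_ (sq_mul_sq_le_sum_prelu_sq ha z ⟨0, hd⟩)
  have := ha.1
  positivity

/-- The integral is the derivative at `-y` of the moment generating function, computed by
differentiating `mgf_id_halfSqLaw` term by term. -/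
lemma lintegral_mul_exp_halfSqLaw (a : ℝ) (d : ℕ) {y : ℝ} (hy : 0 < y) :
    ∫⁻ q, ENNReal.ofReal (q * Real.exp (-(y * q))) ∂halfSqLaw a d
      = ENNReal.ofReal (∑ n ∈ Finset.range (d + 1), binomWeight d n *
        ((n : ℝ) / 2 * (1 + y) ^ (-((n : ℝ) / 2) - 1) * (1 + a ^ 2 * y) ^ (-(((d : ℝ) - n) / 2))
        + a ^ 2 * (((d : ℝ) - n) / 2) * (1 + y) ^ (-((n : ℝ) / 2))
          * (1 + a ^ 2 * y) ^ (-(((d : ℝ) - n) / 2) - 1))) := by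
  have h1 : 0 < 1 + y := by linarith
  have h2 : 0 < 1 + a ^ 2 * y := by positivity
  -- Every `t < 0` is admissible, since `exp (t q) ≤ 1` for `q ≥ 0`.
  have hmem : -y ∈ interior (integrableExpSet id (halfSqLaw a d)) := by
    rw [mem_interior_iff_mem_nhds]
    filter_upwards [Iio_mem_nhds (neg_lt_zero.2 hy)] with t ht
    refine (integrable_const (1 : ℝ)).mono (by fun_prop) ?_
    filter_upwards [halfSqLaw_nonneg a d] with q hq
    rw [Real.norm_of_nonneg (Real.exp_pos _).le, norm_one]
    exact Real.exp_le_one_iff.2 (mul_nonpos_of_nonpos_of_nonneg (le_of_lt ht) hq)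
  have hint : Integrable (fun q => q * Real.exp (-(y * q))) (halfSqLaw a d) := by
    simpa using integrable_pow_mul_exp_of_mem_interior_integrableExpSet hmem 1
  rw [← ofReal_integral_eq_lintegral_ofReal hint]
  swap
  · filter_upwards [halfSqLaw_nonneg a d] with q hq
    exact mul_nonneg hq (Real.exp_pos _).le
  congr 1
  have hev : mgf id (halfSqLaw a d) =ᶠ[𝓝 (-y)] fun t => ∑ n ∈ Finset.range (d + 1), binomWeight d n *
        ((1 - t) ^ (-((n : ℝ) / 2)) * (1 - a ^ 2 * t) ^ (-(((d : ℝ) - n) / 2))) := by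
    filter_upwards [Iio_mem_nhds (neg_lt_zero.2 hy)] with t ht
    have := mgf_id_halfSqLaw a d (y := -t) (by simpa using ht)
    rw [neg_neg] at this
    simpa [sub_eq_add_neg] using this
  have hd1 := (hasDerivAt_mgf hmem).congr_of_eventuallyEq hev.symm
  have hd2 : HasDerivAt (fun t => ∑ n ∈ Finset.range (d + 1), binomWeight d n *
        ((1 - t) ^ (-((n : ℝ) / 2)) * (1 - a ^ 2 * t) ^ (-(((d : ℝ) - n) / 2))))
      (∑ n ∈ Finset.range (d + 1), binomWeight d n *
        (-1 * -((n : ℝ) / 2) * (1 - -y) ^ (-((n : ℝ) / 2) - 1)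
            * (1 - a ^ 2 * -y) ^ (-(((d : ℝ) - n) / 2))
          + (1 - -y) ^ (-((n : ℝ) / 2)) * (-(a ^ 2 * 1) * -(((d : ℝ) - n) / 2)
            * (1 - a ^ 2 * -y) ^ (-(((d : ℝ) - n) / 2) - 1)))) (-y) := by
    refine HasDerivAt.fun_sum fun n _ => HasDerivAt.const_mul _ (HasDerivAt.fun_mul
      (HasDerivAt.rpow_const (p := -((n : ℝ) / 2)) ((hasDerivAt_id (-y)).const_sub 1) (Or.inl ?_))
      (HasDerivAt.rpow_const (p := -(((d : ℝ) - n) / 2))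
        (((hasDerivAt_id (-y)).const_mul (a ^ 2)).const_sub 1) (Or.inl ?_)))
    · linarith
    · linarith
  have := hd1.unique hd2
  simp only [id, neg_mul] at this
  rw [this]
  refine Finset.sum_congr rfl fun n _ => ?_
  rw [show 1 - -y = 1 + y by ring, show 1 - a ^ 2 * -y = 1 + a ^ 2 * y by ring]
  ring

lemma binomWeight_pos {d n : ℕ} (hn : n ≤ d) : 0 < binomWeight d n := by
  have := Nat.choose_pos hn
  unfold binomWeight
  positivity

lemma sum_binomWeight (d : ℕ) : ∑ n ∈ Finset.range (d + 1), binomWeight d n = 1 := by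
  unfold binomWeight
  rw [← Finset.sum_div]
  have := Nat.sum_range_choose d
  rw [div_eq_one_iff_eq (by positivity)]
  exact_mod_cast this

/-- The law of the quotient of a standard exponential variable by an independent variable with law
`halfSqLaw` is a mixture of beta prime distributions. -/
lemma map_div_halfSqLaw_prod_stdExp {a : ℝ} (ha : a ∈ Ioc (0 : ℝ) 1) {d : ℕ} (hd : 0 < d) :
    ((halfSqLaw a d).prod stdExp).map (fun p => p.2 / p.1)
      = Measure.sum fun i : Fin (d + 1) × ℕ =>
          ENNReal.ofReal (binomWeight d i.1 * wCoeff a d i.1 i.2) •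
            betaPrime ((i.2 : ℝ) + 1) ((d : ℝ) / 2) := by
  rw [map_div_prod_stdExp (halfSqLaw_pos ha hd)]
  have hmeas (i : Fin (d + 1) × ℕ) : Measurable fun y : ℝ =>
      ENNReal.ofReal (y ^ ((i.2 : ℝ) + 1 - 1) * (1 + y) ^ (-((i.2 : ℝ) + 1 + (d : ℝ) / 2))) := by
    fun_prop
  have hterm (i : Fin (d + 1) × ℕ) :
      ENNReal.ofReal (binomWeight d i.1 * wCoeff a d i.1 i.2) •
            betaPrime ((i.2 : ℝ) + 1) ((d : ℝ) / 2)
        = (volume.restrict (Ioi 0)).withDensity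
          (ENNReal.ofReal (binomWeight d i.1 * wCoeff a d i.1 i.2) • fun y : ℝ =>
            ENNReal.ofReal (y ^ ((i.2 : ℝ) + 1 - 1) * (1 + y) ^ (-((i.2 : ℝ) + 1 + (d : ℝ) / 2)))) := by
    rw [betaPrime, withDensity_smul _ (hmeas i)]
  simp_rw [hterm]
  rw [← withDensity_tsum fun i => (hmeas i).const_smul _]
  refine withDensity_congr_ae ((ae_restrict_iff' measurableSet_Ioi).2 (ae_of_all _ fun y hy => ?_))
  have hy : 0 < y := hy
  beta_reduce
  -- Pointwise in `y`, the sum over pairs splits into a finite sum over `n` and, for each `n`, the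
  -- series of `hasSum_wCoeff`.
  rw [lintegral_mul_exp_halfSqLaw a d hy, tsum_apply (Pi.summable.2 fun _ => ENNReal.summable), ENNReal.summable.tsum_prod' fun _ => ENNReal.summable,
    tsum_fintype, ← Fin.sum_univ_eq_sum_range (fun n => binomWeight d n *
        ((n : ℝ) / 2 * (1 + y) ^ (-((n : ℝ) / 2) - 1) * (1 + a ^ 2 * y) ^ (-(((d : ℝ) - n) / 2))
        + a ^ 2 * (((d : ℝ) - n) / 2) * (1 + y) ^ (-((n : ℝ) / 2))
          * (1 + a ^ 2 * y) ^ (-(((d : ℝ) - n) / 2) - 1))) (d + 1)]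
  have hnn (n : Fin (d + 1)) (k : ℕ) : 0 ≤ wCoeff a d n k :=
    wCoeff_nonneg ha (Nat.lt_succ_iff.1 n.2) k
  have hH (n : Fin (d + 1)) := hasSum_wCoeff ha d n hy
  have hH0 (n : Fin (d + 1)) (k : ℕ) : 0 ≤ wCoeff a d n k *
      (y ^ ((k : ℝ) + 1 - 1) * (1 + y) ^ (-((k : ℝ) + 1 + (d : ℝ) / 2))) := by
    have := hnn n k
    positivity
  have hb (n : Fin (d + 1)) : 0 ≤ binomWeight d n := (binomWeight_pos (Nat.lt_succ_iff.1 n.2)).le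
  rw [ENNReal.ofReal_sum_of_nonneg fun n _ => mul_nonneg (hb n) ((hH n).nonneg (hH0 n))]
  refine Finset.sum_congr rfl fun n _ => ?_
  rw [← ((hH n).mul_left _).tsum_eq, ENNReal.ofReal_tsum_of_nonneg
    (fun k => mul_nonneg (hb n) (hH0 n k)) ((hH n).mul_left _).summable]
  refine tsum_congr fun k => ?_
  simp only [Pi.smul_apply, smul_eq_mul]
  rw [← ENNReal.ofReal_mul (mul_nonneg (hb n) (hnn n k)), mul_assoc]

/-! ### Logarithmic moments -/

/-- The singularity at `0` is integrable because `-1/2 > -1`. This controls a negative moment of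
`halfSqLaw`. -/
lemma integrable_abs_rpow_gaussianReal :
    Integrable (fun z : ℝ => |z| ^ (-(1 / 2) : ℝ)) (gaussianReal 0 1) := by
  rw [gaussianReal_of_var_ne_zero 0 one_ne_zero,
    integrable_withDensity_iff_integrable_smul' (measurable_gaussianPDF 0 1)
      (ae_of_all _ fun _ => gaussianPDF_lt_top)]
  have h : IntegrableOn (fun x : ℝ => (gaussianPDF 0 1 x).toReal • |x| ^ (-(1 / 2) : ℝ)) (Ioi 0) := by
    have h0 := (integrableOn_rpow_mul_exp_neg_mul_sq (b := 1 / 2) (by norm_num)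
      (s := -(1 / 2)) (by norm_num)).const_mul (√(2 * Real.pi))⁻¹
    refine IntegrableOn.congr_fun h0 (fun x (hx : 0 < x) => ?_) measurableSet_Ioi
    simp only [toReal_gaussianPDF, gaussianPDFReal, abs_of_pos hx, smul_eq_mul]
    norm_num
    ring_nf
  rw [← integrableOn_univ, ← @Iio_union_Ici _ _ (0 : ℝ), integrableOn_union,
    integrableOn_Ici_iff_integrableOn_Ioi]
  refine ⟨?_, h⟩
  -- The negative half-line reduces to the positive one by reflection.
  rw [← (Measure.measurePreserving_neg (volume : Measure ℝ)).integrableOn_comp_preimage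
      (Homeomorph.neg ℝ).measurableEmbedding]
  simp only [Function.comp_def, neg_preimage, neg_Iio, neg_zero]
  convert! h using 3 with x
  · simp [gaussianPDF, gaussianPDFReal]
  · rw [abs_neg]

/-- The moments of order `±1/4` of `Q` are finite, so all logarithmic moments exist. For the
negative one, a single coordinate suffices: `Q ≥ a² z² / 2` gives `Q^(-1/4) ≤ C |z|^(-1/2)`. For the
positive one, `Q^(1/4) ≤ 1 + Q`. -/
lemma zero_mem_interior_integrableExpSet_log_halfSqLaw {a : ℝ} (ha : a ∈ Ioc (0 : ℝ) 1) {d : ℕ}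
    (hd : 0 < d) : (0 : ℝ) ∈ interior (integrableExpSet Real.log (halfSqLaw a d)) := by
  have ha0 := ha.1
  have hneg : Integrable (fun q => Real.exp (-(1 / 4 : ℝ) * Real.log q)) (halfSqLaw a d) := by
    rw [halfSqLaw, integrable_map_measure (by fun_prop) (measurable_sum_prelu_sq a).aemeasurable]
    have hm := measurePreserving_eval (fun _ : Fin d => gaussianReal 0 1) ⟨0, hd⟩
    have hz := hm.integrable_comp_of_integrable
      (integrable_abs_rpow_gaussianReal.const_mul (Real.exp (-(1 / 4 : ℝ) * Real.log (a ^ 2 / 2))))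
    refine hz.mono (Measurable.aestronglyMeasurable (by fun_prop)) ?_
    filter_upwards [ae_pi_gaussianReal_ne_zero ⟨0, hd⟩] with z hz
    have hz' := abs_pos.2 hz
    have hle := sq_mul_sq_le_sum_prelu_sq ha z ⟨0, hd⟩
    simp only [Function.comp_apply, Function.eval]
    rw [Real.norm_of_nonneg (Real.exp_pos _).le, Real.norm_of_nonneg (by positivity),
      Real.rpow_def_of_pos hz', ← Real.exp_add, Real.exp_le_exp]
    have h1 : Real.log (a ^ 2 * z ⟨0, hd⟩ ^ 2 / 2) ≤ Real.log (∑ i, prelu a (z i) ^ 2 / 2) :=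
      Real.log_le_log (by positivity) hle
    have h2 : Real.log (a ^ 2 * z ⟨0, hd⟩ ^ 2 / 2)
        = Real.log (a ^ 2 / 2) + 2 * Real.log |z ⟨0, hd⟩| := by
      rw [← sq_abs (z _), show a ^ 2 * |z ⟨0, hd⟩| ^ 2 / 2 = a ^ 2 / 2 * |z ⟨0, hd⟩| ^ 2 by ring,
        Real.log_mul (by positivity) (by positivity), Real.log_pow]
      norm_num
    linarith
  have hq : Integrable (fun q : ℝ => q) (halfSqLaw a d) := by
    rw [halfSqLaw, integrable_map_measure (by fun_prop) (measurable_sum_prelu_sq a).aemeasurable]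
    refine integrable_finsetSum _ fun i _ => ?_
    have hm := measurePreserving_eval (fun _ : Fin d => gaussianReal 0 1) i
    have hz := hm.integrable_comp_of_integrable
      (memLp_id_gaussianReal (μ := 0) (v := 1) 2).integrable_sq
    refine hz.mono (Measurable.aestronglyMeasurable (by fun_prop)) (ae_of_all _ fun z => ?_)
    simp only [Function.comp_apply, Function.eval, id]
    rw [Real.norm_of_nonneg (by positivity), Real.norm_of_nonneg (by positivity)]
    have := prelu_sq_le ha (z i)
    have := sq_nonneg (z i)
    linarith
  have hpos : Integrable (fun q => Real.exp ((1 / 4 : ℝ) * Real.log q)) (halfSqLaw a d) := by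
    refine ((integrable_const (1 : ℝ)).add hq).mono (by fun_prop) ?_
    filter_upwards [halfSqLaw_pos ha hd] with q hq
    simp only [Pi.add_apply]
    rw [Real.norm_of_nonneg (Real.exp_pos _).le, Real.norm_of_nonneg (by positivity)]
    rcases le_or_gt q 1 with h | h
    · have := Real.exp_le_one_iff.2 (show (1 / 4 : ℝ) * Real.log q ≤ 0 by
        have := Real.log_nonpos hq.le h
        linarith)
      linarith
    · have h1 := Real.log_pos h
      have := Real.exp_le_exp.2 (show (1 / 4 : ℝ) * Real.log q ≤ Real.log q by linarith)
      rw [Real.exp_log hq] at this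
      linarith
  rw [mem_interior_iff_mem_nhds]
  filter_upwards [Icc_mem_nhds (show (-(1 / 4) : ℝ) < 0 by norm_num) (show (0 : ℝ) < 1 / 4 by norm_num)]
    with s hs
  exact integrable_exp_mul_of_le_of_le hneg hpos hs.1 hs.2

/-- For equal parameters the second logarithmic moment of the beta prime law is `2 B(p, p) ψ₁(p)`,
and it is the integral of a square. -/
lemma psiOne_nonneg {p : ℝ} (hp : 0 < p) : 0 ≤ psiOne p := by
  have h := (moments_log_betaPrime hp hp).2.2.2
  have h0 : 0 ≤ ∫ y, Real.log y ^ 2 ∂(betaPrime p p) := integral_nonneg fun y => sq_nonneg _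
  rw [h] at h0
  have := nonneg_of_mul_nonneg_right h0 (beta_pos hp hp)
  simp only [sub_self] at this
  linarith

section Moments

variable {a : ℝ} {d : ℕ}

lemma integrable_log_halfSqLaw (ha : a ∈ Ioc (0 : ℝ) 1) (hd : 0 < d) :
    Integrable Real.log (halfSqLaw a d) := by
  simpa using integrable_pow_of_mem_interior_integrableExpSet
    (zero_mem_interior_integrableExpSet_log_halfSqLaw ha hd) 1

lemma integrable_log_sq_halfSqLaw (ha : a ∈ Ioc (0 : ℝ) 1) (hd : 0 < d) :
    Integrable (fun q => Real.log q ^ 2) (halfSqLaw a d) :=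
  integrable_pow_of_mem_interior_integrableExpSet
    (zero_mem_interior_integrableExpSet_log_halfSqLaw ha hd) 2

lemma ae_log_div_prod_stdExp (ha : a ∈ Ioc (0 : ℝ) 1) (hd : 0 < d) :
    ∀ᵐ p ∂(halfSqLaw a d).prod stdExp, Real.log (p.2 / p.1) = Real.log p.2 - Real.log p.1 := by
  have h2 : ∀ᵐ x ∂stdExp, 0 < x :=
    (withDensity_absolutelyContinuous _ _).ae_le (ae_restrict_mem measurableSet_Ioi)
  filter_upwards [Measure.quasiMeasurePreserving_fst.ae (halfSqLaw_pos ha hd),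
    Measure.quasiMeasurePreserving_snd.ae h2] with p hp1 hp2
  exact Real.log_div hp2.ne' hp1.ne'

/-- Independence factorises the cross term in `(log E - log Q)²`, so the moments of `log Q` can be
read off from those of the quotient. -/
lemma moments_log_div (ha : a ∈ Ioc (0 : ℝ) 1) (hd : 0 < d) :
    let M := ((halfSqLaw a d).prod stdExp).map (fun p => p.2 / p.1)
    Integrable Real.log M ∧ Integrable (fun t => Real.log t ^ 2) M ∧
      ∫ t, Real.log t ∂M = psiZero 1 - ∫ q, Real.log q ∂halfSqLaw a d ∧
      ∫ t, Real.log t ^ 2 ∂M = psiZero 1 ^ 2 + psiOne 1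
        - 2 * (psiZero 1 * ∫ q, Real.log q ∂halfSqLaw a d)
        + ∫ q, Real.log q ^ 2 ∂halfSqLaw a d := by
  intro M
  obtain ⟨e1, e2, m1, m2⟩ := moments_log_stdExp
  have q1 := integrable_log_halfSqLaw ha hd
  have q2 := integrable_log_sq_halfSqLaw ha hd
  have hae := ae_log_div_prod_stdExp ha hd
  have hae2 : (fun p : ℝ × ℝ => Real.log (p.2 / p.1) ^ 2)
      =ᵐ[(halfSqLaw a d).prod stdExp] fun p => Real.log p.2 ^ 2
        - 2 * (Real.log p.1 * Real.log p.2) + Real.log p.1 ^ 2 := by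
    filter_upwards [hae] with p hp
    rw [hp]
    ring
  have i1 := (e1.comp_snd (halfSqLaw a d)).sub (q1.comp_fst stdExp)
  have c1 := (q1.mul_prod e1).const_mul 2
  have c2 : Integrable (fun p : ℝ × ℝ => Real.log p.2 ^ 2 - 2 * (Real.log p.1 * Real.log p.2))
      ((halfSqLaw a d).prod stdExp) := (e2.comp_snd (halfSqLaw a d)).sub c1
  have i2 := c2.add (q2.comp_fst stdExp)
  have hT : AEMeasurable (fun p : ℝ × ℝ => p.2 / p.1) ((halfSqLaw a d).prod stdExp) := by fun_prop
  refine ⟨?_, ?_, ?_, ?_⟩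
  · rw [integrable_map_measure (by fun_prop) hT]
    exact i1.congr (hae.mono fun p hp => hp.symm)
  · rw [integrable_map_measure (by fun_prop) hT]
    exact i2.congr (hae2.mono fun p hp => hp.symm)
  · rw [integral_map hT (by fun_prop), integral_congr_ae hae,
      integral_sub (e1.comp_snd (halfSqLaw a d)) (q1.comp_fst stdExp), integral_fun_snd,
      integral_fun_fst, m1]
    simp
  · rw [integral_map hT (by fun_prop), integral_congr_ae hae2,
      integral_add c2 (q2.comp_fst stdExp),
      integral_sub (e2.comp_snd (halfSqLaw a d)) c1,
      integral_fun_snd (fun y => Real.log y ^ 2), integral_fun_fst (fun y => Real.log y ^ 2),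
      integral_const_mul, integral_prod_mul, m1, m2]
    simp
    ring

/-- An integral against a countable mixture is a convergent series of integrals; all summability
claims about the explicit series originate here. -/
lemma hasSum_of_integrable_map_div (ha : a ∈ Ioc (0 : ℝ) 1) (hd : 0 < d) {f : ℝ → ℝ}
    (hf : Integrable f (((halfSqLaw a d).prod stdExp).map (fun p => p.2 / p.1))) :
    HasSum (fun i : Fin (d + 1) × ℕ => binomWeight d i.1 * wCoeff a d i.1 i.2 *
        ∫ y, f y ∂betaPrime ((i.2 : ℝ) + 1) ((d : ℝ) / 2))
      (∫ t, f t ∂(((halfSqLaw a d).prod stdExp).map (fun p => p.2 / p.1))) := by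
  rw [map_div_halfSqLaw_prod_stdExp ha hd] at hf ⊢
  have h := hasSum_integral_measure hf
  refine h.congr_fun fun i => ?_
  have hi := Nat.lt_succ_iff.1 i.1.2
  rw [integral_smul_measure, ENNReal.toReal_ofReal
    (mul_nonneg (binomWeight_pos hi).le (wCoeff_nonneg ha hi _)), smul_eq_mul]

end Moments

/-! ### Convergence of the series and closed forms of `lyapunovExponent` and `limitVariance` -/

section Series

variable {a : ℝ} {d : ℕ}

lemma hasSum_wBeta_prod (ha : a ∈ Ioc (0 : ℝ) 1) (hd : 0 < d) :
    HasSum (fun i : Fin (d + 1) × ℕ => binomWeight d i.1 * wBeta a d i.1 i.2) 1 := by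
  have hd2 : (0 : ℝ) < (d : ℝ) / 2 := by positivity
  have hprob : IsProbabilityMeasure
      (((halfSqLaw a d).prod stdExp).map (fun p => p.2 / p.1)) :=
    Measure.isProbabilityMeasure_map (by fun_prop)
  have h := hasSum_of_integrable_map_div ha hd (integrable_const (1 : ℝ))
  rw [integral_const, probReal_univ, one_smul] at h
  refine h.congr_fun fun i => ?_
  have hk : (0 : ℝ) < (i.2 : ℝ) + 1 := by positivity
  rw [integral_const, Measure.real, betaPrime_univ hk hd2,
    ENNReal.toReal_ofReal (beta_pos hk hd2).le, wBeta, smul_eq_mul, mul_one, mul_assoc]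

lemma hasSum_psiDiff_wBeta_prod (ha : a ∈ Ioc (0 : ℝ) 1) (hd : 0 < d) :
    HasSum (fun i : Fin (d + 1) × ℕ => binomWeight d i.1 * (psiDiff d i.2 * wBeta a d i.1 i.2))
      (∫ q, Real.log q ∂halfSqLaw a d - psiZero 1) := by
  have hd2 : (0 : ℝ) < (d : ℝ) / 2 := by positivity
  obtain ⟨i1, -, m1, -⟩ := moments_log_div ha hd
  -- The sign changes because `psiDiff` is `ψ₀(d/2) - ψ₀(k+1)`, the opposite of the normalised
  -- logarithmic mean of the beta prime law.
  have h := (hasSum_of_integrable_map_div ha hd i1).neg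
  rw [m1, neg_sub] at h
  refine h.congr_fun fun i => ?_
  have hk : (0 : ℝ) < (i.2 : ℝ) + 1 := by positivity
  rw [(moments_log_betaPrime hk hd2).2.2.1, wBeta, psiDiff]
  ring

lemma hasSum_psiDiff_sq_wBeta_prod (ha : a ∈ Ioc (0 : ℝ) 1) (hd : 0 < d) :
    HasSum (fun i : Fin (d + 1) × ℕ => binomWeight d i.1 *
        ((psiDiff d i.2 ^ 2 + (psiOne ((i.2 : ℝ) + 1) + psiOne ((d : ℝ) / 2))) * wBeta a d i.1 i.2))
      (psiZero 1 ^ 2 + psiOne 1 - 2 * (psiZero 1 * ∫ q, Real.log q ∂halfSqLaw a d)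
        + ∫ q, Real.log q ^ 2 ∂halfSqLaw a d) := by
  have hd2 : (0 : ℝ) < (d : ℝ) / 2 := by positivity
  obtain ⟨-, i2, -, m2⟩ := moments_log_div ha hd
  have h := hasSum_of_integrable_map_div ha hd i2
  rw [m2] at h
  refine h.congr_fun fun i => ?_
  have hk : (0 : ℝ) < (i.2 : ℝ) + 1 := by positivity
  rw [(moments_log_betaPrime hk hd2).2.2.2, wBeta, psiDiff]
  ring

lemma wBeta_nonneg (ha : a ∈ Ioc (0 : ℝ) 1) (hd : 0 < d) {n : ℕ} (hn : n ≤ d) (k : ℕ) :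
    0 ≤ wBeta a d n k :=
  mul_nonneg (wCoeff_nonneg ha hn k) (beta_pos (by positivity) (by positivity)).le

lemma summable_of_summable_prod {F : ℕ → ℕ → ℝ}
    (h : Summable fun i : Fin (d + 1) × ℕ => binomWeight d i.1 * F i.1 i.2) {n : ℕ} (hn : n ≤ d) :
    Summable (F n) :=
  (summable_mul_left_iff (binomWeight_pos hn).ne').1
    (h.prod_factor ⟨n, Nat.lt_succ_of_le hn⟩)

lemma sum_tsum_of_hasSum_prod {F : ℕ → ℕ → ℝ} {S : ℝ}
    (h : HasSum (fun i : Fin (d + 1) × ℕ => binomWeight d i.1 * F i.1 i.2) S) :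
    ∑ n ∈ Finset.range (d + 1), binomWeight d n * ∑' k, F n k = S := by
  rw [← Fin.sum_univ_eq_sum_range (fun n => binomWeight d n * ∑' k, F n k)]
  refine (hasSum_fintype _).unique (h.prod_fiberwise fun n => ?_)
  exact (summable_of_summable_prod h.summable (Nat.lt_succ_iff.1 n.2)).hasSum.mul_left _

lemma summable_wBeta (ha : a ∈ Ioc (0 : ℝ) 1) (hd : 0 < d) {n : ℕ} (hn : n ≤ d) :
    Summable fun k => wBeta a d n k :=
  summable_of_summable_prod (F := wBeta a d) (hasSum_wBeta_prod ha hd).summable hn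

lemma summable_psiDiff_mul_wBeta (ha : a ∈ Ioc (0 : ℝ) 1) (hd : 0 < d) {n : ℕ} (hn : n ≤ d) :
    Summable fun k => psiDiff d k * wBeta a d n k :=
  summable_of_summable_prod (F := fun n k => psiDiff d k * wBeta a d n k)
    (hasSum_psiDiff_wBeta_prod ha hd).summable hn

lemma summable_psiDiff_sq_add_mul_wBeta (ha : a ∈ Ioc (0 : ℝ) 1) (hd : 0 < d) {n : ℕ}
    (hn : n ≤ d) : Summable fun k : ℕ => (psiDiff d k ^ 2
      + (psiOne ((k : ℝ) + 1) + psiOne ((d : ℝ) / 2))) * wBeta a d n k :=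
  summable_of_summable_prod (F := fun n k => (psiDiff d k ^ 2
    + (psiOne ((k : ℝ) + 1) + psiOne ((d : ℝ) / 2))) * wBeta a d n k)
    (hasSum_psiDiff_sq_wBeta_prod ha hd).summable hn

/-- The second moment only yields summability of a combined series; its pieces are nonnegative, so
each is dominated by the whole. -/
lemma summable_psiDiff_sq_mul_wBeta (ha : a ∈ Ioc (0 : ℝ) 1) (hd : 0 < d) {n : ℕ} (hn : n ≤ d) :
    Summable fun k => psiDiff d k ^ 2 * wBeta a d n k := by
  refine (summable_psiDiff_sq_add_mul_wBeta ha hd hn).of_nonneg_of_le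
    (fun k => mul_nonneg (sq_nonneg _) (wBeta_nonneg ha hd hn k)) fun k => ?_
  have h1 := psiOne_nonneg (p := (k : ℝ) + 1) (by positivity)
  have h2 := psiOne_nonneg (p := (d : ℝ) / 2) (by positivity)
  exact mul_le_mul_of_nonneg_right (by linarith) (wBeta_nonneg ha hd hn k)

lemma summable_psiOne_mul_wBeta (ha : a ∈ Ioc (0 : ℝ) 1) (hd : 0 < d) {n : ℕ} (hn : n ≤ d) :
    Summable fun k : ℕ => psiOne ((k : ℝ) + 1) * wBeta a d n k := by
  have h1 (k : ℕ) := psiOne_nonneg (p := (k : ℝ) + 1) (by positivity)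
  refine (summable_psiDiff_sq_add_mul_wBeta ha hd hn).of_nonneg_of_le
    (fun k => mul_nonneg (h1 k) (wBeta_nonneg ha hd hn k)) fun k => ?_
  have h2 := psiOne_nonneg (p := (d : ℝ) / 2) (by positivity)
  exact mul_le_mul_of_nonneg_right (by linarith [sq_nonneg (psiDiff d k)])
    (wBeta_nonneg ha hd hn k)

lemma summable_psiOne_sub_mul_wBeta (ha : a ∈ Ioc (0 : ℝ) 1) (hd : 0 < d) {n : ℕ} (hn : n ≤ d) :
    Summable fun k : ℕ => (psiOne ((k : ℝ) + 1) - psiOne 1) * wBeta a d n k := by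
  simpa only [sub_mul] using
    (summable_psiOne_mul_wBeta ha hd hn).sub ((summable_wBeta ha hd hn).mul_left (psiOne 1))

/-- The mean `ψ₀(1) = -γ` of `log E` cancels the `-γ` in `mSeries`. -/
lemma sum_binomWeight_mul_mSeries (ha : a ∈ Ioc (0 : ℝ) 1) (hd : 0 < d) :
    ∑ n ∈ Finset.range (d + 1), binomWeight d n * mSeries a d n
      = Real.log 2 + ∫ q, Real.log q ∂halfSqLaw a d := by
  simp only [mSeries, mul_add, Finset.sum_add_distrib (f := fun n => binomWeight d n * _),
    ← Finset.sum_mul, sum_binomWeight]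
  rw [sum_tsum_of_hasSum_prod (F := fun n k => psiDiff d k * wBeta a d n k)
    (hasSum_psiDiff_wBeta_prod ha hd), psiZero_one]
  ring

lemma lyapunovExponent_eq (ha : a ∈ Ioc (0 : ℝ) 1) (hd : 0 < d) (σ : ℝ) :
    lyapunovExponent a σ d
      = Real.log σ + 1 / 2 * (Real.log 2 + ∫ q, Real.log q ∂halfSqLaw a d) := by
  rw [lyapunovExponent, sum_binomWeight_mul_mSeries ha hd]

/-- In `v_n + m_n²` the squared series cancel. What remains is linear in the three series whose
averages over `n` are the mass and the first two logarithmic moments of the mixture. -/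
lemma limitVariance_eq (ha : a ∈ Ioc (0 : ℝ) 1) (hd : 0 < d) :
    limitVariance a d = 1 / 4 * (∫ q, Real.log q ^ 2 ∂halfSqLaw a d
      - (∫ q, Real.log q ∂halfSqLaw a d) ^ 2) := by
  set c : ℝ := Real.log 2 - Real.eulerMascheroniConstant with hc
  have h0 := sum_tsum_of_hasSum_prod (F := wBeta a d) (hasSum_wBeta_prod ha hd)
  have h1 := sum_tsum_of_hasSum_prod (F := fun n k => psiDiff d k * wBeta a d n k)
    (hasSum_psiDiff_wBeta_prod ha hd)
  have h2 := sum_tsum_of_hasSum_prod (F := fun n k => (psiDiff d k ^ 2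
    + (psiOne ((k : ℝ) + 1) + psiOne ((d : ℝ) / 2))) * wBeta a d n k)
    (hasSum_psiDiff_sq_wBeta_prod ha hd)
  have key (n : ℕ) (hn : n ∈ Finset.range (d + 1)) :
      binomWeight d n * vSeries a d n + binomWeight d n * mSeries a d n ^ 2
        = binomWeight d n * (psiOne ((d : ℝ) / 2) + c ^ 2)
          + binomWeight d n * (∑' k : ℕ, (psiDiff d k ^ 2
            + (psiOne ((k : ℝ) + 1) + psiOne ((d : ℝ) / 2))) * wBeta a d n k)
          + 2 * c * (binomWeight d n * ∑' k, psiDiff d k * wBeta a d n k)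
          - (psiOne 1 + psiOne ((d : ℝ) / 2)) * (binomWeight d n * ∑' k, wBeta a d n k) := by
    have hn : n ≤ d := Nat.lt_succ_iff.1 (Finset.mem_range.1 hn)
    have s0 := summable_wBeta ha hd hn
    have s2 := summable_psiDiff_sq_mul_wBeta ha hd hn
    have s3 := summable_psiOne_mul_wBeta ha hd hn
    simp only [vSeries, mSeries, ← hc, sub_mul, add_mul]
    rw [s3.tsum_sub (s0.mul_left _), s2.tsum_add (s3.add (s0.mul_left _)),
      s3.tsum_add (s0.mul_left _), tsum_mul_left, tsum_mul_left]
    ring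
  rw [limitVariance, ← Finset.sum_add_distrib, Finset.sum_congr rfl key, Finset.sum_sub_distrib,
    Finset.sum_add_distrib, Finset.sum_add_distrib, ← Finset.mul_sum, ← Finset.mul_sum,
    ← Finset.sum_mul, sum_binomWeight, h0, h1, h2, sum_binomWeight_mul_mSeries ha hd, psiZero_one,
    hc]
  ring

end Series

/-! ### Gaussian matrices applied to a fixed vector -/

/-- Pairing the vector with `t` gives a sum of independent centred Gaussians of variances `v t_i²
c_j²`, whose total is `∑ t_i²`: the characteristic function is the standard Gaussian one. -/
lemma map_sum_mul_gaussianReal {Ω : Type*} [MeasurableSpace Ω] {P : Measure Ω}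
    [IsProbabilityMeasure P] {d : ℕ} {w : Fin d × Fin d → Ω → ℝ} {v : NNReal}
    (hmeas : ∀ p, Measurable (w p)) (hlaw : ∀ p, P.map (w p) = gaussianReal 0 v)
    (hind : iIndepFun w P) {c : Fin d → ℝ} (hc : (v : ℝ) * ∑ j, c j ^ 2 = 1) :
    P.map (fun ω i => ∑ j, w (i, j) ω * c j) = Measure.pi fun _ : Fin d => gaussianReal 0 1 := by
  have hm : Measurable fun ω (i : Fin d) => ∑ j, w (i, j) ω * c j := by fun_prop
  have : IsProbabilityMeasure (P.map fun ω (i : Fin d) => ∑ j, w (i, j) ω * c j) :=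
    Measure.isProbabilityMeasure_map hm.aemeasurable
  rw [← charFun_eq_pi_iff]
  intro t
  have hcomp : iIndepFun (fun p ω => t p.1 * c p.2 * w p ω) P :=
    hind.comp (fun p x => t p.1 * c p.2 * x) fun p => by fun_prop
  have e1 : charFun ((P.map fun ω (i : Fin d) => ∑ j, w (i, j) ω * c j).map (WithLp.toLp 2)) t
      = charFun (P.map fun ω => ∑ p, t p.1 * c p.2 * w p ω) 1 := by
    rw [Measure.map_map (by fun_prop) hm, charFun_apply, charFun_apply,
      integral_map (by fun_prop) (by fun_prop), integral_map (by fun_prop) (by fun_prop)]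
    refine integral_congr_ae (ae_of_all _ fun ω => ?_)
    simp only [Function.comp_apply, PiLp.inner_apply, Fintype.sum_prod_type]
    congr 3
    simp only [RCLike.inner_apply, conj_trivial, one_mul, Finset.mul_sum]
    refine Finset.sum_congr rfl fun i _ => Finset.sum_congr rfl fun j _ => ?_
    ring
  rw [e1, hcomp.charFun_map_fun_sum_eq_prod fun p => by fun_prop, Finset.prod_apply]
  simp_rw [charFun_map_mul_comp (hmeas _).aemeasurable, hlaw, charFun_gaussianReal,
    ← Complex.exp_sum]
  congr 1
  have hc' : (v : ℂ) * ∑ j, (c j : ℂ) ^ 2 = 1 := by exact_mod_cast hc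
  simp only [Fintype.sum_prod_type]
  refine Finset.sum_congr rfl fun i _ => ?_
  calc _ = -(t i : ℂ) ^ 2 / 2 * ((v : ℂ) * ∑ j, (c j : ℂ) ^ 2) := by
        rw [Finset.mul_sum, Finset.mul_sum]
        refine Finset.sum_congr rfl fun j _ => ?_
        push_cast
        ring
    _ = _ := by
        rw [hc']
        push_cast
        ring

/-! ### Functions of independent variables with a constant conditional law -/

/-- Conditionally on `m₁`, which fixes `X`, the variable `g X Z` has the law `κ` whatever the value
of `X`; so it is independent of `m₁` although it depends on `X`. -/
lemma measure_inter_preimage_of_indep {Ω α β γ : Type*} {m₁ mΩ : MeasurableSpace Ω}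
    [MeasurableSpace α] [MeasurableSpace β] [MeasurableSpace γ] {P : Measure Ω}
    [IsProbabilityMeasure P] (hm₁ : m₁ ≤ mΩ) {X : Ω → α} {Z : Ω → β} (hX : Measurable[m₁] X)
    (hZ : Measurable Z) (hind : Indep m₁ (MeasurableSpace.comap Z inferInstance) P)
    {g : α → β → γ} (hg : Measurable (Function.uncurry g)) {κ : Measure γ}
    (hκ : ∀ x, P.map (fun ω => g x (Z ω)) = κ) {B : Set Ω} (hB : MeasurableSet[m₁] B) {A : Set γ}
    (hA : MeasurableSet A) : P (B ∩ {ω | g (X ω) (Z ω) ∈ A}) = P B * κ A := by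
  -- The event `B` travels with `X` as a `Prop`-valued variable, so that one product formula for a
  -- joint law is enough.
  have hXB : Measurable[m₁] fun ω => (X ω, ω ∈ B) := by
    have hb : Measurable[m₁] fun ω => ω ∈ B := (@measurableSet_setOfPred _ m₁ _).1 hB
    exact hX.prodMk hb
  have hXB' : Measurable fun ω => (X ω, ω ∈ B) := hXB.mono hm₁ le_rfl
  have hI : IndepFun (fun ω => (X ω, ω ∈ B)) Z P :=
    (IndepFun_iff_Indep _ _ _).2 (indep_of_indep_of_le_left hind hXB.comap_le)
  have hprod := (indepFun_iff_map_prod_eq_prod_map_map hXB'.aemeasurable hZ.aemeasurable).1 hI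
  have hS : MeasurableSet {p : (α × Prop) × β | p.1.2 ∧ g p.1.1 p.2 ∈ A} := by
    refine MeasurableSet.inter ?_ ?_
    · exact measurableSet_setOfPred.2 (measurable_snd.comp measurable_fst)
    · exact (hg.comp ((measurable_fst.comp measurable_fst).prodMk measurable_snd)) hA
  have hgx (x : α) : Measurable fun z => g x z := hg.comp measurable_prodMk_left
  have : IsProbabilityMeasure (P.map Z) := Measure.isProbabilityMeasure_map hZ.aemeasurable
  calc P (B ∩ {ω | g (X ω) (Z ω) ∈ A})
      = P.map (fun ω => ((X ω, ω ∈ B), Z ω)) {p | p.1.2 ∧ g p.1.1 p.2 ∈ A} := by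
        rw [Measure.map_apply (hXB'.prodMk hZ) hS]
        rfl
    _ = ∫⁻ ω, P.map Z {z | (ω ∈ B) ∧ g (X ω) z ∈ A} ∂P := by
        rw [hprod, Measure.prod_apply hS, lintegral_map (measurable_measure_prodMk_left hS) hXB']
        rfl
    _ = ∫⁻ ω, B.indicator (fun _ => κ A) ω ∂P := by
        refine lintegral_congr fun ω => ?_
        by_cases hω : ω ∈ B
        · rw [indicator_of_mem hω, ← hκ (X ω),
            Measure.map_apply (f := fun ω' => g (X ω) (Z ω')) ((hgx _).comp hZ) hA]
          simp only [hω, true_and]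
          exact Measure.map_apply hZ ((hgx (X ω)) hA)
        · simp [hω]
    _ = _ := by rw [lintegral_indicator_const (hm₁ _ hB), mul_comm]

/-- A sequence of random variables with a common law is independent as soon as each of them is
independent of the preceding ones. -/
lemma iIndepFun_of_measure_inter_preimage {Ω γ : Type*} {mΩ : MeasurableSpace Ω}
    [MeasurableSpace γ] {P : Measure Ω} [IsProbabilityMeasure P] {m : ℕ → MeasurableSpace Ω}
    (hmono : Monotone m) {Q : ℕ → Ω → γ}
    (hQ : ∀ n, Measurable[m (n + 1)] (Q n)) {κ : Measure γ} (h : ∀ n B A, MeasurableSet[m n] B →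
      MeasurableSet A → P (B ∩ Q n ⁻¹' A) = P B * κ A) :
    iIndepFun Q P := by
  have hκ (n : ℕ) (A : Set γ) (hA : MeasurableSet A) : P (Q n ⁻¹' A) = κ A := by
    simpa using h n univ A (@MeasurableSet.univ _ (m n)) hA
  have key (A : ℕ → Set γ) (hA : ∀ i, MeasurableSet (A i)) (n : ℕ) :
      MeasurableSet[m n] (⋂ i ∈ Finset.range n, Q i ⁻¹' A i) ∧
      P (⋂ i ∈ Finset.range n, Q i ⁻¹' A i) = ∏ i ∈ Finset.range n, κ (A i) := by
    induction n with
    | zero => simp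
    | succ n ih =>
      rw [Finset.range_add_one, Finset.set_biInter_insert, inter_comm,
        Finset.prod_insert Finset.notMem_range_self]
      refine ⟨?_, ?_⟩
      · exact @MeasurableSet.inter _ (m (n + 1)) _ _ (hmono n.le_succ _ ih.1) (hQ n (hA n))
      · rw [h n _ _ ih.1 (hA n), ih.2, mul_comm]
  rw [iIndepFun_iff_measure_inter_preimage_eq_mul]
  intro S sets hsets
  classical
  obtain ⟨N, hN⟩ := S.exists_nat_subset_range
  -- Indices outside `S` are filled with `univ`, of mass `1`, to reduce to an initial segment.
  have hA (i : ℕ) : MeasurableSet (if i ∈ S then sets i else univ) := by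
    split_ifs with hi
    · exact hsets i hi
    · exact MeasurableSet.univ
  have h1 := (key (fun i => if i ∈ S then sets i else univ) hA N).2
  have h2 : (⋂ i ∈ Finset.range N, Q i ⁻¹' (if i ∈ S then sets i else univ))
      = ⋂ i ∈ S, Q i ⁻¹' sets i := by
    ext ω
    simp only [mem_iInter, mem_preimage]
    refine ⟨fun h i hi => by simpa [hi] using h i (hN hi), fun h i _ => ?_⟩
    split_ifs with hi
    · exact h i hi
    · trivial
  have huniv : κ univ = 1 := by rw [← hκ 0 univ MeasurableSet.univ]; simp
  rw [h2] at h1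
  rw [h1, ← Finset.prod_subset hN (f := fun i => κ (if i ∈ S then sets i else univ))
    fun i _ hi => by simp [hi, huniv]]
  exact Finset.prod_congr rfl fun i hi => by simp [hi, hκ i _ (hsets i hi)]

/-! ### Absolute continuity -/

lemma volume_image_eq_zero_of_differentiableOn {f : ℝ → ℝ} {s : Set ℝ}
    (hf : DifferentiableOn ℝ f s) (hs : volume s = 0) : volume (f '' s) = 0 :=
  addHaar_image_eq_zero_of_differentiableOn_of_addHaar_eq_zero volume hf hs

/-- The preimage of a null set lies in its images under the branches `√(2t)` and `-a⁻¹ √(2t)`,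
together with `{0}`. Both branches are differentiable for `t > 0`, hence send null sets to null
sets. -/
lemma map_prelu_sq_gaussianReal_absolutelyContinuous {a : ℝ} (ha : 0 < a) :
    (gaussianReal 0 1).map (fun z => prelu a z ^ 2 / 2) ≪ volume := by
  refine Measure.AbsolutelyContinuous.mk fun s hs h0 => ?_
  rw [Measure.map_apply (by fun_prop) hs]
  refine gaussianReal_absolutelyContinuous 0 one_ne_zero ?_
  have hs' : volume (s ∩ Ioi 0) = 0 := measure_mono_null inter_subset_left h0
  have hd : DifferentiableOn ℝ (fun t : ℝ => √(2 * t)) (s ∩ Ioi 0) := by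
    intro t ht
    have : 0 < t := ht.2
    exact (DifferentiableAt.sqrt (by fun_prop) (by positivity)).differentiableWithinAt
  have h1 := volume_image_eq_zero_of_differentiableOn hd hs'
  have h2 := volume_image_eq_zero_of_differentiableOn (hd.const_mul (-a⁻¹)) hs'
  refine measure_mono_null (fun z hz => ?_)
    (measure_union_null (measure_union_null h1 h2) (Real.volume_singleton (a := 0)))
  have hz : prelu a z ^ 2 / 2 ∈ s := hz
  rw [prelu_sq] at hz
  rcases lt_trichotomy z 0 with hlt | rfl | hgt
  · rw [if_neg hlt.not_gt] at hz
    refine Or.inl (Or.inr ⟨_, ⟨hz, ?_⟩, ?_⟩)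
    · have : z ≠ 0 := hlt.ne
      have : 0 < a ^ 2 * z ^ 2 / 2 := by positivity
      exact this
    · simp only
      rw [show 2 * (a ^ 2 * z ^ 2 / 2) = (a * -z) ^ 2 by ring,
        Real.sqrt_sq (mul_nonneg ha.le (by linarith))]
      field_simp
  · exact Or.inr rfl
  · rw [if_pos hgt] at hz
    refine Or.inl (Or.inl ⟨_, ⟨hz, ?_⟩, ?_⟩)
    · have : 0 < z ^ 2 / 2 := by positivity
      exact this
    · simp only
      rw [show 2 * (z ^ 2 / 2) = z ^ 2 by ring, Real.sqrt_sq hgt.le]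

/-- One absolutely continuous independent summand suffices, by convolution. -/
lemma halfSqLaw_absolutelyContinuous {a : ℝ} (ha : 0 < a) {d : ℕ} (hd : 0 < d) :
    halfSqLaw a d ≪ volume := by
  have hind := iIndepFun_pi (μ := fun _ : Fin d => gaussianReal 0 1)
    (X := fun _ z => prelu a z ^ 2 / 2) (fun i => by fun_prop)
  have hmeas (i : Fin d) : Measurable fun z : Fin d → ℝ => prelu a (z i) ^ 2 / 2 := by fun_prop
  set i₀ : Fin d := ⟨0, hd⟩
  have hI := hind.indepFun_finsetSum_of_notMem hmeas
    (s := Finset.univ.erase i₀) (i := i₀) (Finset.notMem_erase _ _)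
  have hlaw : (Measure.pi fun _ : Fin d => gaussianReal 0 1).map
      (fun z => prelu a (z i₀) ^ 2 / 2) ≪ volume := by
    have hm := measurePreserving_eval (fun _ : Fin d => gaussianReal 0 1) i₀
    have h := map_prelu_sq_gaussianReal_absolutelyContinuous ha
    rw [← hm.map_eq, Measure.map_map (by fun_prop) hm.measurable] at h
    exact h
  have e : (fun z : Fin d → ℝ => ∑ i, prelu a (z i) ^ 2 / 2)
      = (∑ i ∈ Finset.univ.erase i₀, fun z : Fin d → ℝ => prelu a (z i) ^ 2 / 2)
        + fun z : Fin d → ℝ => prelu a (z i₀) ^ 2 / 2 := by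
    rw [Finset.sum_erase_add _ _ (Finset.mem_univ i₀)]
    ext z
    simp
  rw [halfSqLaw, e, hI.map_add_eq_map_conv_map (by fun_prop) (hmeas i₀)]
  exact Measure.conv_absolutelyContinuous hlaw

lemma map_log_absolutelyContinuous {κ : Measure ℝ} (hκ : κ ≪ volume) (hpos : ∀ᵐ q ∂κ, 0 < q) :
    κ.map Real.log ≪ volume := by
  refine Measure.AbsolutelyContinuous.mk fun s hs h0 => ?_
  rw [Measure.map_apply (by fun_prop) hs]
  have h1 := hκ (volume_image_eq_zero_of_differentiableOn
    (Real.differentiable_exp.differentiableOn (s := s)) h0)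
  refine measure_mono_null (t := Real.exp '' s ∪ {q | ¬ 0 < q}) (fun q hq => ?_)
    (measure_union_null h1 hpos)
  by_cases h : 0 < q
  · exact Or.inl ⟨_, hq, Real.exp_log h⟩
  · exact Or.inr h

/-! ### The layers of the network -/

section Network

variable {d : ℕ}

/-- The input of a layer, rescaled to have norm `σ⁻¹`; a zero input is replaced by `x₀`. -/
noncomputable def scaledDir (σ : ℝ) (x₀ x : EuclideanSpace ℝ (Fin d)) : EuclideanSpace ℝ (Fin d) :=
  if x = 0 then (σ * ‖x₀‖)⁻¹ • x₀ else (σ * ‖x‖)⁻¹ • x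

/-- The replacement of a zero input by `x₀` serves this normalisation: it holds for every `x`, so
the law of the gain has no exceptional case. -/
lemma sum_scaledDir_sq {σ : ℝ} (hσ : 0 < σ) {x₀ : EuclideanSpace ℝ (Fin d)} (hx₀ : x₀ ≠ 0)
    (x : EuclideanSpace ℝ (Fin d)) : σ ^ 2 * ∑ j, scaledDir σ x₀ x j ^ 2 = 1 := by
  have key (y : EuclideanSpace ℝ (Fin d)) (hy : y ≠ 0) :
      σ ^ 2 * ‖(σ * ‖y‖)⁻¹ • y‖ ^ 2 = 1 := by
    have := norm_pos_iff.2 hy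
    rw [norm_smul, Real.norm_of_nonneg (by positivity)]
    field_simp
  have h : ∑ j, scaledDir σ x₀ x j ^ 2 = ‖scaledDir σ x₀ x‖ ^ 2 := by
    rw [EuclideanSpace.real_norm_sq_eq]
  rw [h]
  unfold scaledDir
  split_ifs with hx
  · exact key x₀ hx₀
  · exact key x hx

@[fun_prop]
lemma measurable_scaledDir (σ : ℝ) (x₀ : EuclideanSpace ℝ (Fin d)) :
    Measurable (scaledDir σ x₀) := by
  refine Measurable.ite (measurableSet_singleton 0) measurable_const ?_
  fun_prop

/-- Half the squared norm of the output of a layer, relative to `σ` times the norm of its input. -/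
noncomputable def layerGain (a σ : ℝ) (x₀ x : EuclideanSpace ℝ (Fin d)) (w : Fin d → Fin d → ℝ) :
    ℝ :=
  ∑ i, prelu a (∑ j, w i j * scaledDir σ x₀ x j) ^ 2 / 2

lemma measurable_layerGain (a σ : ℝ) (x₀ : EuclideanSpace ℝ (Fin d)) :
    Measurable (Function.uncurry (layerGain a σ x₀)) := by
  unfold Function.uncurry layerGain
  have h (j : Fin d) : Measurable fun p : EuclideanSpace ℝ (Fin d) × (Fin d → Fin d → ℝ) =>
      scaledDir σ x₀ p.1 j := by fun_prop
  refine Finset.measurable_sum _ fun i _ => ?_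
  refine (((measurable_prelu a).comp (Finset.measurable_sum _ fun j _ => ?_)).pow_const 2).div_const 2
  exact Measurable.mul (by fun_prop) (h j)

lemma prelu_mul {s : ℝ} (hs : 0 < s) (a z : ℝ) : prelu a (s * z) = s * prelu a z := by
  unfold prelu
  simp only [mul_pos_iff_of_pos_left hs]
  split_ifs <;> ring

lemma norm_layerMap_sq {a σ : ℝ} (hσ : 0 < σ) (x₀ : EuclideanSpace ℝ (Fin d))
    {x : EuclideanSpace ℝ (Fin d)} (hx : x ≠ 0) (w : Matrix (Fin d) (Fin d) ℝ) :
    ‖layerMap a w 0 x‖ ^ 2 = ‖x‖ ^ 2 * σ ^ 2 * (2 * layerGain a σ x₀ x w) := by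
  have hx' := norm_pos_iff.2 hx
  have hgain : layerGain a σ x₀ x w
      = ∑ i, prelu a (∑ j, w i j * scaledDir σ x₀ x j) ^ 2 / 2 := rfl
  rw [EuclideanSpace.real_norm_sq_eq, hgain, Finset.mul_sum, Finset.mul_sum]
  refine Finset.sum_congr rfl fun i _ => ?_
  have e : w.mulVec x.ofLp i + (0 : EuclideanSpace ℝ (Fin d)) i
      = (σ * ‖x‖) * ∑ j, w i j * scaledDir σ x₀ x j := by
    simp only [PiLp.zero_apply, add_zero, Matrix.mulVec, dotProduct, scaledDir, if_neg hx,
      PiLp.smul_apply, smul_eq_mul, Finset.mul_sum]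
    refine Finset.sum_congr rfl fun j _ => ?_
    field_simp
  simp only [layerMap]
  rw [e, prelu_mul (by positivity)]
  ring

end Network

/-! ### Independence and common law of the layer gains -/

section RandomNetwork

variable {d : ℕ}

/-- Measurability is asked only of the weights before layer `n`, for an arbitrary σ-algebra; with
`weightAlgebra W (Iio n)` this says that the output is adapted. -/
lemma measurable_netOutput {Ω : Type*} [MeasurableSpace Ω] (a : ℝ)
    {W : ℕ → Ω → Matrix (Fin d) (Fin d) ℝ} (b : ℕ → EuclideanSpace ℝ (Fin d))
    (x₀ : EuclideanSpace ℝ (Fin d)) (n : ℕ)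
    (hW : ∀ k < n, ∀ i j, Measurable fun ω => W k ω i j) :
    Measurable fun ω => netOutput a (fun j => W j ω) b x₀ n := by
  induction n with
  | zero => exact measurable_const
  | succ n ih =>
    have h := ih fun k hk => hW k (by lia)
    have hx (j : Fin d) : Measurable fun ω => netOutput a (fun j => W j ω) b x₀ n j :=
      (measurable_pi_apply j).comp ((WithLp.measurable_ofLp 2 _).comp h)
    refine (WithLp.measurable_toLp 2 _).comp (measurable_pi_lambda _ fun i => ?_)
    refine (measurable_prelu a).comp (Measurable.add_const ?_ _)
    have hs : Measurable fun ω =>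
        ∑ j, W n ω i j * netOutput a (fun j => W j ω) b x₀ n j :=
      Finset.measurable_sum _ fun j _ => Measurable.mul (hW n (by lia) i j) (hx j)
    exact hs

/-- The gain of layer `n + 1` of the network along its input. -/
noncomputable def netGain {Ω : Type*} (a σ : ℝ) (W : ℕ → Ω → Matrix (Fin d) (Fin d) ℝ)
    (b : ℕ → EuclideanSpace ℝ (Fin d)) (x₀ : EuclideanSpace ℝ (Fin d)) (n : ℕ) (ω : Ω) : ℝ :=
  layerGain a σ x₀ (netOutput a (fun j => W j ω) b x₀ n) fun i j => W n ω i j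

lemma measurable_netGain {Ω : Type*} [MeasurableSpace Ω] (a σ : ℝ)
    {W : ℕ → Ω → Matrix (Fin d) (Fin d) ℝ} (b : ℕ → EuclideanSpace ℝ (Fin d))
    (x₀ : EuclideanSpace ℝ (Fin d)) (n : ℕ)
    (hW : ∀ k < n + 1, ∀ i j, Measurable fun ω => W k ω i j) :
    Measurable (netGain a σ W b x₀ n) := by
  have h1 := measurable_netOutput a b x₀ n fun k hk => hW k (by lia)
  have h2 : Measurable fun ω (i j : Fin d) => W n ω i j :=
    measurable_pi_lambda _ fun i => measurable_pi_lambda _ fun j => hW n n.lt_succ_self i j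
  have h3 := (measurable_layerGain a σ x₀).comp (h1.prodMk h2)
  have e : netGain a σ W b x₀ n = Function.uncurry (layerGain a σ x₀) ∘
      fun ω => (netOutput a (fun j => W j ω) b x₀ n, fun i j => W n ω i j) := by
    funext ω
    simp only [netGain, Function.comp_apply, Function.uncurry_apply_pair]
  rw [e]
  exact h3

/-- The σ-algebra generated by the weights of the layers with index in `S`. -/
@[reducible] def weightAlgebra {Ω : Type*} (W : ℕ → Ω → Matrix (Fin d) (Fin d) ℝ) (S : Set ℕ) :
    MeasurableSpace Ω :=
  ⨆ p ∈ {p : ℕ × Fin d × Fin d | p.1 ∈ S},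
    MeasurableSpace.comap (fun ω => W p.1 ω p.2.1 p.2.2) inferInstance

lemma measurable_weightAlgebra {Ω : Type*} (W : ℕ → Ω → Matrix (Fin d) (Fin d) ℝ) {S : Set ℕ}
    {k : ℕ} (hk : k ∈ S) (i j : Fin d) : Measurable[weightAlgebra W S] fun ω => W k ω i j := by
  refine Measurable.of_comap_le ?_
  exact le_iSup₂ (f := fun (p : ℕ × Fin d × Fin d) (_ : p ∈ {p : ℕ × Fin d × Fin d | p.1 ∈ S}) =>
    MeasurableSpace.comap (fun ω => W p.1 ω p.2.1 p.2.2) inferInstance) (k, i, j) hk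

lemma weightAlgebra_mono {Ω : Type*} (W : ℕ → Ω → Matrix (Fin d) (Fin d) ℝ) {S T : Set ℕ}
    (h : S ⊆ T) : weightAlgebra W S ≤ weightAlgebra W T :=
  biSup_mono fun _ hp => h hp

/-- The increment of `log ‖x‖` in a layer with gain `q`. -/
noncomputable def logIncrement (σ q : ℝ) : ℝ := Real.log σ + 1 / 2 * (Real.log 2 + Real.log q)

@[fun_prop]
lemma measurable_logIncrement (σ : ℝ) : Measurable (logIncrement σ) := by
  unfold logIncrement
  fun_prop

variable {Ω : Type*} {a σ : ℝ} {W : ℕ → Ω → Matrix (Fin d) (Fin d) ℝ}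
  {b : ℕ → EuclideanSpace ℝ (Fin d)} {x₀ : EuclideanSpace ℝ (Fin d)}

lemma netOutput_succ_ne_zero_and_logNormOutput_succ (hσ : 0 < σ) (hb : ∀ k, b k = 0) {n : ℕ}
    {ω : Ω} (hx : netOutput a (fun j => W j ω) b x₀ n ≠ 0) (hq : 0 < netGain a σ W b x₀ n ω) :
    netOutput a (fun j => W j ω) b x₀ (n + 1) ≠ 0 ∧
      logNormOutput a W b x₀ (n + 1) ω
        = logNormOutput a W b x₀ n ω + logIncrement σ (netGain a σ W b x₀ n ω) := by
  have h : ‖netOutput a (fun j => W j ω) b x₀ (n + 1)‖ ^ 2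
      = ‖netOutput a (fun j => W j ω) b x₀ n‖ ^ 2 * σ ^ 2 * (2 * netGain a σ W b x₀ n ω) := by
    rw [netOutput, hb n]
    exact norm_layerMap_sq hσ x₀ hx (W n ω)
  have hx' := norm_pos_iff.2 hx
  have hne : netOutput a (fun j => W j ω) b x₀ (n + 1) ≠ 0 := by
    rw [← norm_ne_zero_iff]
    intro h0
    rw [h0] at h
    have : 0 < ‖netOutput a (fun j => W j ω) b x₀ n‖ ^ 2 * σ ^ 2 * (2 * netGain a σ W b x₀ n ω) := by
      positivity
    rw [← h] at this
    simp at this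
  refine ⟨hne, ?_⟩
  have hl := congrArg Real.log h
  rw [Real.log_mul (by positivity) (by positivity), Real.log_mul (by positivity) (by positivity),
    Real.log_mul (by positivity) hq.ne', Real.log_pow, Real.log_pow, Real.log_pow] at hl
  simp only [logNormOutput, logIncrement]
  push_cast at hl
  linarith

lemma netOutput_ne_zero_and_logNormOutput_eq (hσ : 0 < σ) (hb : ∀ k, b k = 0) (hx₀ : x₀ ≠ 0)
    {ω : Ω} (hq : ∀ n, 0 < netGain a σ W b x₀ n ω) (n : ℕ) :
    netOutput a (fun j => W j ω) b x₀ n ≠ 0 ∧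
      logNormOutput a W b x₀ n ω
        = Real.log ‖x₀‖ + ∑ k ∈ Finset.range n, logIncrement σ (netGain a σ W b x₀ k ω) := by
  induction n with
  | zero => exact ⟨hx₀, by simp [logNormOutput, netOutput]⟩
  | succ n ih =>
    obtain ⟨h1, h2⟩ := netOutput_succ_ne_zero_and_logNormOutput_succ hσ hb ih.1 (hq n)
    exact ⟨h1, by rw [h2, ih.2, Finset.sum_range_succ, add_assoc]⟩

variable [MeasurableSpace Ω] {P : Measure Ω}

lemma IsGaussianInit.measurable_netGain (hinit : IsGaussianInit P σ W b) (n : ℕ) :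
    Measurable (netGain a σ W b x₀ n) :=
  _root_.measurable_netGain a σ b x₀ n fun k _ => hinit.measurable_weight k

variable [IsProbabilityMeasure P]

lemma IsGaussianInit.map_layerGain (hinit : IsGaussianInit P σ W b) (hσ : 0 < σ) (hx₀ : x₀ ≠ 0)
    (n : ℕ) (x : EuclideanSpace ℝ (Fin d)) :
    P.map (fun ω => layerGain a σ x₀ x (fun i j => W n ω i j)) = halfSqLaw a d := by
  have hm (p : Fin d × Fin d) : Measurable fun ω => W n ω p.1 p.2 :=
    hinit.measurable_weight n p.1 p.2
  have hind : iIndepFun (fun (p : Fin d × Fin d) ω => W n ω p.1 p.2) P :=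
    hinit.weight_indep.precomp (g := fun p : Fin d × Fin d => (n, p)) fun p q h => by simpa using h
  have h := map_sum_mul_gaussianReal (c := fun j => scaledDir σ x₀ x j) hm
    (fun p => hinit.weight_law n p.1 p.2) hind
    (by rw [Real.coe_toNNReal _ (sq_nonneg σ)]; exact sum_scaledDir_sq hσ hx₀ x)
  rw [halfSqLaw, ← h, Measure.map_map (by fun_prop)
    (measurable_pi_lambda _ fun i => Finset.measurable_sum _ fun j _ => (hm (i, j)).mul_const _)]
  rfl

/-- The weights of layer `n` are independent of the earlier ones, and for each fixed input the gain
has law `halfSqLaw`; hence the gain is independent of the whole past. -/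
lemma IsGaussianInit.measure_inter_netGain (hinit : IsGaussianInit P σ W b) (hσ : 0 < σ)
    (hx₀ : x₀ ≠ 0) (n : ℕ) {B : Set Ω} {A : Set ℝ}
    (hB : MeasurableSet[weightAlgebra W (Iio n)] B) (hA : MeasurableSet A) :
    P (B ∩ netGain a σ W b x₀ n ⁻¹' A) = P B * halfSqLaw a d A := by
  have hle (p : ℕ × Fin d × Fin d) :
      MeasurableSpace.comap (fun ω => W p.1 ω p.2.1 p.2.2) inferInstance ≤ ‹MeasurableSpace Ω› :=
    (hinit.measurable_weight p.1 p.2.1 p.2.2).comap_le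
  have hZ' : Measurable[weightAlgebra W {n}] fun ω (i j : Fin d) => W n ω i j :=
    @measurable_pi_lambda _ _ _ (weightAlgebra W {n}) _ _ fun i =>
      @measurable_pi_lambda _ _ _ (weightAlgebra W {n}) _ _ fun j =>
        measurable_weightAlgebra W (mem_singleton n) i j
  have hZ : Measurable fun ω (i j : Fin d) => W n ω i j :=
    measurable_pi_lambda _ fun i => measurable_pi_lambda _ fun j => hinit.measurable_weight n i j
  have hind : Indep (weightAlgebra W (Iio n)) (weightAlgebra W {n}) P := by
    refine indep_iSup_of_disjoint hle hinit.weight_indep ?_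
    rw [Set.disjoint_left]
    intro p hp hp'
    have h1 : p.1 < n := hp
    have h2 : p.1 = n := hp'
    lia
  have hX := @measurable_netOutput d Ω (weightAlgebra W (Iio n)) a W b x₀ n
    fun k hk i j => measurable_weightAlgebra W (mem_Iio.2 hk) i j
  have h := measure_inter_preimage_of_indep
    (X := fun ω => netOutput a (fun j => W j ω) b x₀ n)
    (Z := fun ω (i j : Fin d) => W n ω i j) (g := layerGain a σ x₀)
    (iSup₂_le fun p _ => hle p) hX hZ
    (indep_of_indep_of_le_right hind hZ'.comap_le) (measurable_layerGain a σ x₀)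
    (fun x => hinit.map_layerGain hσ hx₀ n x) hB hA
  have e : netGain a σ W b x₀ n ⁻¹' A
      = {ω | layerGain a σ x₀ (netOutput a (fun j => W j ω) b x₀ n) (fun i j => W n ω i j) ∈ A} := by
    ext ω
    simp only [netGain, mem_preimage, mem_ofPred_eq]
  rw [e]
  exact h

lemma IsGaussianInit.iIndepFun_netGain (hinit : IsGaussianInit P σ W b) (hσ : 0 < σ)
    (hx₀ : x₀ ≠ 0) : iIndepFun (netGain a σ W b x₀) P :=
  iIndepFun_of_measure_inter_preimage (m := fun n => weightAlgebra W (Iio n))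
    (fun _ _ h => weightAlgebra_mono W (Iio_subset_Iio h))
    (fun n => @_root_.measurable_netGain d Ω (weightAlgebra W (Iio (n + 1))) a σ W b x₀ n
      fun _ hk i j => measurable_weightAlgebra W (mem_Iio.2 hk) i j)
    fun n _ _ hB hA => hinit.measure_inter_netGain hσ hx₀ n hB hA

lemma IsGaussianInit.map_netGain (hinit : IsGaussianInit P σ W b) (hσ : 0 < σ) (hx₀ : x₀ ≠ 0)
    (n : ℕ) : P.map (netGain a σ W b x₀ n) = halfSqLaw a d := by
  ext A hA
  rw [Measure.map_apply (hinit.measurable_netGain n) hA]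
  simpa using hinit.measure_inter_netGain (a := a) hσ hx₀ n
    (@MeasurableSet.univ _ (weightAlgebra W (Iio n))) hA

lemma IsGaussianInit.indepFun_netOutput_netGain (hinit : IsGaussianInit P σ W b) (hσ : 0 < σ)
    (hx₀ : x₀ ≠ 0) (n : ℕ) :
    IndepFun (fun ω => netOutput a (fun j => W j ω) b x₀ n) (netGain a σ W b x₀ n) P := by
  rw [indepFun_iff_measure_inter_preimage_eq_mul]
  intro s t hs ht
  have hX := @measurable_netOutput d Ω (weightAlgebra W (Iio n)) a W b x₀ n
    fun k hk i j => measurable_weightAlgebra W (mem_Iio.2 hk) i j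
  rw [hinit.measure_inter_netGain hσ hx₀ n (hX hs) ht, ← hinit.map_netGain hσ hx₀ n,
    Measure.map_apply (hinit.measurable_netGain n) ht]

lemma IsGaussianInit.ae_netGain_pos (hinit : IsGaussianInit P σ W b) (ha : a ∈ Ioc (0 : ℝ) 1)
    (hσ : 0 < σ) (hd : 0 < d) (hx₀ : x₀ ≠ 0) : ∀ᵐ ω ∂P, ∀ n, 0 < netGain a σ W b x₀ n ω := by
  rw [ae_all_iff]
  intro n
  have h := halfSqLaw_pos ha hd
  rw [← hinit.map_netGain hσ hx₀ n] at h
  exact ae_of_ae_map (hinit.measurable_netGain n).aemeasurable h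

end RandomNetwork

/-! ### Transfer of limits between sequences with the same one-dimensional laws -/

lemma TendstoInMeasure.congr_map {Ω Ω' : Type*} [MeasurableSpace Ω] [MeasurableSpace Ω']
    {P : Measure Ω} {P' : Measure Ω'} {X : ℕ → Ω → ℝ} {Y : ℕ → Ω' → ℝ} {c : ℝ}
    (hX : ∀ k, Measurable (X k)) (hY : ∀ k, Measurable (Y k))
    (h : ∀ k, 1 ≤ k → P'.map (Y k) = P.map (X k)) (hlim : TendstoInMeasure P X atTop fun _ => c) :
    TendstoInMeasure P' Y atTop fun _ => c := by
  intro ε hε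
  refine (hlim ε hε).congr' ?_
  -- No law is prescribed at index `0`, which the limit ignores.
  filter_upwards [eventually_ge_atTop 1] with k hk
  have hS : MeasurableSet {x : ℝ | ε ≤ edist x c} :=
    measurableSet_le measurable_const (by fun_prop)
  have h1 := Measure.map_apply (μ := P') (hY k) hS
  have h2 := Measure.map_apply (μ := P) (hX k) hS
  rw [h k hk] at h1
  exact h2.symm.trans h1

lemma TendstoInDistribution.congr_map {Ω Ω' Ω'' : Type*} [MeasurableSpace Ω] [MeasurableSpace Ω']
    [MeasurableSpace Ω''] {P : Measure Ω} {P' : Measure Ω'} {P'' : Measure Ω''}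
    [IsProbabilityMeasure P] [IsProbabilityMeasure P'] [IsProbabilityMeasure P'']
    {X : ℕ → Ω → ℝ} {Y : ℕ → Ω' → ℝ} {Z : Ω'' → ℝ} (hY : ∀ k, Measurable (Y k))
    (h : ∀ k, 1 ≤ k → P'.map (Y k) = P.map (X k))
    (hlim : TendstoInDistribution X atTop Z (fun _ => P) P'') :
    TendstoInDistribution Y atTop Z (fun _ => P') P'' where
  forall_aemeasurable k := (hY k).aemeasurable
  aemeasurable_limit := hlim.aemeasurable_limit
  tendsto := by
    refine hlim.tendsto.congr' ?_
    filter_upwards [eventually_ge_atTop 1] with k hk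
    exact Subtype.ext (h k hk).symm

lemma cond_eq_self {Ω : Type*} [MeasurableSpace Ω] {P : Measure Ω} [IsProbabilityMeasure P]
    {s : Set Ω} (hs : P sᶜ = 0) : P[|s] = P := by
  have h1 : P.restrict s = P := Measure.restrict_eq_self_of_ae_mem hs
  have h2 : P s = 1 := by
    have h := congrArg (fun μ => μ univ) h1
    simpa using h
  rw [ProbabilityTheory.cond, h1, h2, inv_one, one_smul]

/-! ### Absolute continuity, mean and variance of one logarithmic increment -/

section LogIncrement

variable {a : ℝ} {d : ℕ}

lemma map_logIncrement_absolutelyContinuous (ha : a ∈ Ioc (0 : ℝ) 1) (hd : 0 < d) (σ : ℝ) :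
    (halfSqLaw a d).map (logIncrement σ) ≪ volume := by
  have h := map_log_absolutelyContinuous (halfSqLaw_absolutelyContinuous ha.1 hd)
    (halfSqLaw_pos ha hd)
  have hq : Measure.QuasiMeasurePreserving
      (fun x : ℝ => Real.log σ + 1 / 2 * (Real.log 2 + x)) volume volume := by
    refine ⟨by fun_prop, Measure.AbsolutelyContinuous.mk fun s hs h0 => ?_⟩
    rw [Measure.map_apply (by fun_prop) hs]
    have e : (fun x : ℝ => Real.log σ + 1 / 2 * (Real.log 2 + x)) ⁻¹' s
        = (fun x : ℝ => (1 / 2 : ℝ) * x) ⁻¹'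
          ((fun x : ℝ => x + (Real.log σ + 1 / 2 * Real.log 2)) ⁻¹' s) := by
      ext x
      simp only [mem_preimage]
      ring_nf
    rw [e, Real.volume_preimage_mul_left (by norm_num), measure_preimage_add_right, h0, mul_zero]
  have h' := (h.map hq.1).trans hq.2
  rwa [Measure.map_map (by fun_prop) (by fun_prop)] at h'

lemma integrable_logIncrement (ha : a ∈ Ioc (0 : ℝ) 1) (hd : 0 < d) (σ : ℝ) :
    Integrable (logIncrement σ) (halfSqLaw a d) :=
  (integrable_const _).add (((integrable_const _).add (integrable_log_halfSqLaw ha hd)).const_mul _)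

lemma integral_logIncrement (ha : a ∈ Ioc (0 : ℝ) 1) (hd : 0 < d) (σ : ℝ) :
    ∫ q, logIncrement σ q ∂halfSqLaw a d = lyapunovExponent a σ d := by
  have h := integrable_log_halfSqLaw ha hd
  rw [lyapunovExponent_eq ha hd]
  unfold logIncrement
  have h1 : Integrable (fun q => Real.log 2 + Real.log q) (halfSqLaw a d) :=
    (integrable_const _).add h
  rw [integral_add (integrable_const _) (h1.const_mul _), integral_const_mul,
    integral_add (integrable_const _) h]
  simp

lemma memLp_log_halfSqLaw (ha : a ∈ Ioc (0 : ℝ) 1) (hd : 0 < d) :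
    MemLp Real.log 2 (halfSqLaw a d) :=
  (memLp_two_iff_integrable_sq (Real.measurable_log.aestronglyMeasurable)).2
    (integrable_log_sq_halfSqLaw ha hd)

lemma memLp_logIncrement (ha : a ∈ Ioc (0 : ℝ) 1) (hd : 0 < d) (σ : ℝ) :
    MemLp (logIncrement σ) 2 (halfSqLaw a d) := by
  have h1 : MemLp (fun q => Real.log 2 + Real.log q) 2 (halfSqLaw a d) :=
    MemLp.add (f := fun _ => Real.log 2) (g := Real.log) (memLp_const _)
      (memLp_log_halfSqLaw ha hd)
  have h2 : MemLp (fun q => 1 / 2 * (Real.log 2 + Real.log q)) 2 (halfSqLaw a d) :=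
    h1.const_mul _
  exact MemLp.add (f := fun _ => Real.log σ)
    (g := fun q => 1 / 2 * (Real.log 2 + Real.log q)) (memLp_const _) h2

lemma variance_logIncrement (ha : a ∈ Ioc (0 : ℝ) 1) (hd : 0 < d) (σ : ℝ) :
    Var[logIncrement σ; halfSqLaw a d] = limitVariance a d := by
  have hm : AEStronglyMeasurable Real.log (halfSqLaw a d) :=
    Real.measurable_log.aestronglyMeasurable
  rw [limitVariance_eq ha hd]
  unfold logIncrement
  rw [variance_const_add ((hm.const_add _).const_mul _), variance_const_mul,
    variance_const_add hm, variance_eq_sub (memLp_log_halfSqLaw ha hd)]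
  norm_num

end LogIncrement

/-! ### Densities, law of large numbers and central limit theorem for the network -/

section Limits

variable {d : ℕ} {Ω : Type*} [MeasurableSpace Ω] {P : Measure Ω} {a σ : ℝ}
  {W : ℕ → Ω → Matrix (Fin d) (Fin d) ℝ} {b : ℕ → EuclideanSpace ℝ (Fin d)}
  {x₀ : EuclideanSpace ℝ (Fin d)}

lemma IsGaussianInit.measurable_logNormOutput (hinit : IsGaussianInit P σ W b) (k : ℕ) :
    Measurable (logNormOutput a W b x₀ k) :=
  Real.measurable_log.comp
    (measurable_netOutput a b x₀ k fun k _ => hinit.measurable_weight k).norm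

variable [IsProbabilityMeasure P]

lemma IsGaussianInit.ae_netOutput_ne_zero_and_logNormOutput_eq (hinit : IsGaussianInit P σ W b)
    (ha : a ∈ Ioc (0 : ℝ) 1) (hσ : 0 < σ) (hd : 0 < d) (hx₀ : x₀ ≠ 0) :
    ∀ᵐ ω ∂P, ∀ n, netOutput a (fun j => W j ω) b x₀ n ≠ 0 ∧ logNormOutput a W b x₀ n ω
      = Real.log ‖x₀‖ + ∑ k ∈ Finset.range n, logIncrement σ (netGain a σ W b x₀ k ω) := by
  filter_upwards [hinit.ae_netGain_pos ha hσ hd hx₀] with ω hω n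
  exact netOutput_ne_zero_and_logNormOutput_eq hσ hinit.bias_zero hx₀ hω n

lemma IsGaussianInit.map_logIncrement_netGain (hinit : IsGaussianInit P σ W b) (hσ : 0 < σ)
    (hx₀ : x₀ ≠ 0) (n : ℕ) :
    P.map (fun ω => logIncrement σ (netGain a σ W b x₀ n ω))
      = (halfSqLaw a d).map (logIncrement σ) := by
  rw [← hinit.map_netGain hσ hx₀ n, Measure.map_map (by fun_prop) (hinit.measurable_netGain n)]
  rfl

/-- The last increment is independent of the preceding output and has an absolutely continuous law.
At least one layer is needed, since the input is deterministic. -/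
lemma IsGaussianInit.map_logNormOutput_absolutelyContinuous (hinit : IsGaussianInit P σ W b)
    (ha : a ∈ Ioc (0 : ℝ) 1) (hσ : 0 < σ) (hd : 0 < d) (hx₀ : x₀ ≠ 0) (n : ℕ) :
    P.map (logNormOutput a W b x₀ (n + 1)) ≪ volume := by
  have hind : IndepFun (logNormOutput a W b x₀ n)
      (fun ω => logIncrement σ (netGain a σ W b x₀ n ω)) P :=
    (hinit.indepFun_netOutput_netGain (a := a) hσ hx₀ n).comp
      (φ := fun x => Real.log ‖x‖) (ψ := logIncrement σ) (by fun_prop) (by fun_prop)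
  have hm : Measurable fun ω => logIncrement σ (netGain a σ W b x₀ n ω) :=
    (measurable_logIncrement σ).comp (hinit.measurable_netGain n)
  have e : logNormOutput a W b x₀ (n + 1) =ᵐ[P]
      logNormOutput a W b x₀ n + fun ω => logIncrement σ (netGain a σ W b x₀ n ω) := by
    filter_upwards [hinit.ae_netOutput_ne_zero_and_logNormOutput_eq ha hσ hd hx₀] with ω hω
    rw [(hω (n + 1)).2, Pi.add_apply, (hω n).2, Finset.sum_range_succ, add_assoc]
  rw [Measure.map_congr e, hind.map_add_eq_map_conv_map (hinit.measurable_logNormOutput n) hm,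
    hinit.map_logIncrement_netGain hσ hx₀ n]
  exact Measure.conv_absolutelyContinuous (map_logIncrement_absolutelyContinuous ha hd σ)

lemma IsGaussianInit.cond_outputNeZero (hinit : IsGaussianInit P σ W b)
    (ha : a ∈ Ioc (0 : ℝ) 1) (hσ : 0 < σ) (hd : 0 < d) (hx₀ : x₀ ≠ 0) (k : ℕ) :
    P[|outputNeZero a W b x₀ k] = P := by
  refine cond_eq_self (s := outputNeZero a W b x₀ k) ?_
  have h : ∀ᵐ ω ∂P, ω ∈ outputNeZero a W b x₀ k := by
    filter_upwards [hinit.ae_netOutput_ne_zero_and_logNormOutput_eq ha hσ hd hx₀] with ω hω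
    exact (hω k).1
  exact h

lemma IsGaussianInit.hasPDF_logNormOutput (hinit : IsGaussianInit P σ W b)
    (ha : a ∈ Ioc (0 : ℝ) 1) (hσ : 0 < σ) (hd : 0 < d) (hx₀ : x₀ ≠ 0) {k : ℕ} (hk : 1 ≤ k) :
    HasPDF (logNormOutput a W b x₀ k) P volume := by
  obtain ⟨n, rfl⟩ := Nat.exists_eq_add_of_le' hk
  exact (Real.hasPDF_iff_of_aemeasurable (hinit.measurable_logNormOutput _).aemeasurable).2
    (hinit.map_logNormOutput_absolutelyContinuous ha hσ hd hx₀ n)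

lemma IsGaussianInit.iIndepFun_logIncrement (hinit : IsGaussianInit P σ W b) (hσ : 0 < σ)
    (hx₀ : x₀ ≠ 0) : iIndepFun (fun n ω => logIncrement σ (netGain a σ W b x₀ n ω)) P :=
  (hinit.iIndepFun_netGain hσ hx₀).comp (fun _ => logIncrement σ)
    fun _ => measurable_logIncrement σ

lemma IsGaussianInit.identDistrib_logIncrement (hinit : IsGaussianInit P σ W b) (hσ : 0 < σ)
    (hx₀ : x₀ ≠ 0) (n : ℕ) :
    IdentDistrib (fun ω => logIncrement σ (netGain a σ W b x₀ n ω))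
      (logIncrement σ) P (halfSqLaw a d) where
  aemeasurable_fst := ((measurable_logIncrement σ).comp (hinit.measurable_netGain n)).aemeasurable
  aemeasurable_snd := (measurable_logIncrement σ).aemeasurable
  map_eq := hinit.map_logIncrement_netGain hσ hx₀ n

lemma IsGaussianInit.ae_tendsto_logNormOutput_div (hinit : IsGaussianInit P σ W b)
    (ha : a ∈ Ioc (0 : ℝ) 1) (hσ : 0 < σ) (hd : 0 < d) (hx₀ : x₀ ≠ 0) :
    ∀ᵐ ω ∂P, Tendsto (fun k : ℕ => logNormOutput a W b x₀ k ω / (k : ℝ)) atTop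
      (𝓝 (lyapunovExponent a σ d)) := by
  have hid (n : ℕ) := hinit.identDistrib_logIncrement (a := a) hσ hx₀ n
  have hlln := strong_law_ae_real (fun n ω => logIncrement σ (netGain a σ W b x₀ n ω))
    ((hid 0).integrable_iff.2 (integrable_logIncrement ha hd σ))
    (fun i j hij => (hinit.iIndepFun_logIncrement hσ hx₀).indepFun hij)
    fun n => (hid n).trans (hid 0).symm
  filter_upwards [hlln, hinit.ae_netOutput_ne_zero_and_logNormOutput_eq ha hσ hd hx₀]
    with ω hω hsum
  rw [(hid 0).integral_eq, integral_logIncrement ha hd] at hω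
  have h := (tendsto_const_div_atTop_nhds_zero_nat (Real.log ‖x₀‖)).add hω
  rw [zero_add] at h
  refine h.congr fun k => ?_
  rw [(hsum k).2, add_div]

lemma limitVariance_nonneg (ha : a ∈ Ioc (0 : ℝ) 1) (hd : 0 < d) : 0 ≤ limitVariance a d := by
  -- Any `σ` would do: it only shifts the increment.
  rw [← variance_logIncrement ha hd 0]
  exact variance_nonneg _ _

lemma IsGaussianInit.tendstoInDistribution_logNormOutput (hinit : IsGaussianInit P σ W b)
    (ha : a ∈ Ioc (0 : ℝ) 1) (hσ : 0 < σ) (hd : 0 < d) (hx₀ : x₀ ≠ 0) :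
    TendstoInDistribution
      (fun (k : ℕ) ω => (logNormOutput a W b x₀ k ω - lyapunovExponent a σ d * k) / √(k : ℝ))
      atTop (id : ℝ → ℝ) (fun _ => P) (gaussianReal 0 (limitVariance a d).toNNReal) := by
  have hid (n : ℕ) := hinit.identDistrib_logIncrement (a := a) hσ hx₀ n
  have hvar : Var[fun ω => logIncrement σ (netGain a σ W b x₀ 0 ω); P] = limitVariance a d := by
    rw [(hid 0).variance_eq, variance_logIncrement ha hd]
  have hY : HasLaw (id : ℝ → ℝ)
      (gaussianReal 0 Var[fun ω => logIncrement σ (netGain a σ W b x₀ 0 ω); P].toNNReal)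
      (gaussianReal 0 (limitVariance a d).toNNReal) := by
    rw [hvar]
    exact ⟨aemeasurable_id, Measure.map_id⟩
  have hclt := tendstoInDistribution_inv_sqrt_mul_sum_sub
    (X := fun n ω => logIncrement σ (netGain a σ W b x₀ n ω)) hY
    ((hid 0).memLp_iff.2 (memLp_logIncrement ha hd σ)) (hinit.iIndepFun_logIncrement hσ hx₀)
    fun n => (hid n).trans (hid 0).symm
  have hm (k : ℕ) := hinit.measurable_logNormOutput (a := a) (x₀ := x₀) k
  have hg (k : ℕ) : Measurable fun ω => logIncrement σ (netGain a σ W b x₀ k ω) :=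
    (measurable_logIncrement σ).comp (hinit.measurable_netGain k)
  -- Slutsky: the normalised sum of increments differs from the target by `log ‖x₀‖ / √k`, which
  -- tends to `0`.
  refine tendstoInDistribution_of_tendstoInMeasure_sub _ _ hclt ?_
    fun k => (((hm k).sub_const _).div_const _).aemeasurable
  refine tendstoInMeasure_of_tendsto_ae (fun k => ?_) ?_
  · refine Measurable.aestronglyMeasurable (Measurable.sub (((hm k).sub_const _).div_const _) ?_)
    exact ((Finset.measurable_sum _ fun i _ => hg i).sub_const _).const_mul _
  · filter_upwards [hinit.ae_netOutput_ne_zero_and_logNormOutput_eq ha hσ hd hx₀] with ω hω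
    have h0 : Tendsto (fun k : ℕ => Real.log ‖x₀‖ / √(k : ℝ)) atTop (𝓝 0) :=
      (Real.tendsto_sqrt_atTop.comp tendsto_natCast_atTop_atTop).const_div_atTop _
    refine h0.congr fun k => ?_
    have he : ∫ ω, logIncrement σ (netGain a σ W b x₀ 0 ω) ∂P = lyapunovExponent a σ d := by
      rw [(hid 0).integral_eq, integral_logIncrement ha hd]
    simp only [Pi.sub_apply, (hω k).2, he]
    ring

end Limits

/-! ### The main theorem -/

theorem mainTheorem4 {Ω : Type u} [MeasurableSpace Ω] (P : MeasureTheory.Measure Ω)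
    [MeasureTheory.IsProbabilityMeasure P] (d : ℕ) (a : ℝ) (ha : a ∈ Set.Ioc (0 : ℝ) 1)
    (σ : ℝ) (hσ : 0 < σ) (W : ℕ → Ω → Matrix (Fin d) (Fin d) ℝ)
    (b : ℕ → EuclideanSpace ℝ (Fin d)) (hinit : IsGaussianInit P σ W b)
    (x₀ : EuclideanSpace ℝ (Fin d)) (hx₀ : x₀ ≠ 0) :
    -- the output is almost surely nonzero, and the (conditional) density is well defined
    (∀ k : ℕ, P {ω | netOutput a (fun j => W j ω) b x₀ k = 0} = 0) ∧
    (∀ k : ℕ, 1 ≤ k →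
      MeasureTheory.HasPDF (logNormOutput a W b x₀ k)
        (ProbabilityTheory.cond P (outputNeZero a W b x₀ k)) MeasureTheory.volume ∧
      P.map (logNormOutput a W b x₀ k) =
        MeasureTheory.volume.withDensity (logNormDensity P a W b x₀ k)) ∧
    -- the series in the explicit formulas converge
    (∀ n : ℕ, n ≤ d →
      Summable (fun k : ℕ => psiDiff d k * wBeta a d n k) ∧
      Summable (fun k : ℕ => psiDiff d k ^ 2 * wBeta a d n k) ∧
      Summable (fun k : ℕ => (psiOne ((k : ℝ) + 1) - psiOne 1) * wBeta a d n k)) ∧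
    -- the top Lyapunov exponent along the network
    (∀ᵐ ω ∂P, Filter.Tendsto (fun k : ℕ => logNormOutput a W b x₀ k ω / (k : ℝ))
      Filter.atTop (nhds (lyapunovExponent a σ d))) ∧
    -- limits for arbitrary random variables `R k` with the densities `f_{k,a}`
    0 ≤ limitVariance a d ∧
      ∀ (Ω' : Type v) [MeasurableSpace Ω'] (P' : MeasureTheory.Measure Ω')
        [MeasureTheory.IsProbabilityMeasure P'] (R : ℕ → Ω' → ℝ),
        (∀ k : ℕ, Measurable (R k)) →
        (∀ k : ℕ, 1 ≤ k →
          P'.map (R k) = MeasureTheory.volume.withDensity (logNormDensity P a W b x₀ k)) →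
        MeasureTheory.TendstoInMeasure P' (fun (k : ℕ) ω => R k ω / (k : ℝ)) Filter.atTop
          (fun _ => lyapunovExponent a σ d) ∧
        MeasureTheory.TendstoInDistribution
          (fun (k : ℕ) ω => (R k ω - lyapunovExponent a σ d * (k : ℝ)) / Real.sqrt (k : ℝ))
          Filter.atTop (id : ℝ → ℝ) (fun _ => P')
          (ProbabilityTheory.gaussianReal 0 (limitVariance a d).toNNReal) := by
  have hd : 0 < d := by
    -- In dimension `0` there is no nonzero input.
    refine Nat.pos_of_ne_zero fun h => hx₀ ?_
    subst h
    exact Subsingleton.elim _ _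
  have hlaw (k : ℕ) (hk : 1 ≤ k) : P.map (logNormOutput a W b x₀ k) =
      MeasureTheory.volume.withDensity (logNormDensity P a W b x₀ k) := by
    have := hinit.hasPDF_logNormOutput ha hσ hd hx₀ hk
    rw [logNormDensity, hinit.cond_outputNeZero ha hσ hd hx₀ k]
    exact MeasureTheory.map_eq_withDensity_pdf _ _ _
  have hm (k : ℕ) := hinit.measurable_logNormOutput (a := a) (x₀ := x₀) k
  have hlln := hinit.ae_tendsto_logNormOutput_div ha hσ hd hx₀
  refine ⟨fun k => ?_, fun k hk => ⟨?_, hlaw k hk⟩, fun n hn =>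
    ⟨summable_psiDiff_mul_wBeta ha hd hn, summable_psiDiff_sq_mul_wBeta ha hd hn,
      summable_psiOne_sub_mul_wBeta ha hd hn⟩, hlln, limitVariance_nonneg ha hd,
    fun Ω' _ P' _ R hR hRlaw => ?_⟩
  · refine MeasureTheory.measure_eq_zero_iff_ae_notMem.2 ?_
    filter_upwards [hinit.ae_netOutput_ne_zero_and_logNormOutput_eq ha hσ hd hx₀] with ω hω
    exact (hω k).1
  · rw [hinit.cond_outputNeZero ha hσ hd hx₀ k]
    exact hinit.hasPDF_logNormOutput ha hσ hd hx₀ hk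
  -- Both limits depend only on the law of each `R k`, so they are proved for `logNormOutput` and
  -- transferred.
  · have hmap (k : ℕ) (hk : 1 ≤ k) {g : ℝ → ℝ} (hg : Measurable g) :
        P'.map (fun ω => g (R k ω)) = P.map fun ω => g (logNormOutput a W b x₀ k ω) := by
      have h := congrArg (fun μ => μ.map g) ((hRlaw k hk).trans (hlaw k hk).symm)
      simp only [MeasureTheory.Measure.map_map hg (hR k),
        MeasureTheory.Measure.map_map hg (hm k)] at h
      exact h
    constructor
    · refine TendstoInMeasure.congr_map (fun k => (hm k).div_const _)
        (fun k => (hR k).div_const _) (fun k hk => hmap k hk (g := fun x => x / k) (by fun_prop))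
        (MeasureTheory.tendstoInMeasure_of_tendsto_ae
          (fun k => ((hm k).div_const _).aestronglyMeasurable) hlln)
    · exact TendstoInDistribution.congr_map (fun k => ((hR k).sub_const _).div_const _)
        (fun k hk => hmap k hk
          (g := fun x => (x - lyapunovExponent a σ d * k) / Real.sqrt k) (by fun_prop))
        (hinit.tendstoInDistribution_logNormOutput ha hσ hd hx₀)
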